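/- Let $GF(4)=\{0,1,\omega,\overline{\omega}\}$ with $\overline{\omega}=\omega^2=\omega+1$, and let $C_4^9\subset GF(4)^9$ be the additive code generated (by taking sums) by the ten rows of \[ \begin{pmatrix} 1&0&0&0&0&\overline{\omega}&1&1&1\\ \omega&0&0&0&0&1&\omega&\omega&\omega\\ 0&1&0&0&0&1&\omega&\overline{\omega}&0\\ 0&\omega&0&0&0&\omega&\overline{\omega}&1&0\\ 0&0&1&0&0&0&1&\omega&\overline{\omega}\\ 0&0&\omega&0&0&0&\omega&\overline{\omega}&1\\ 0&0&0&1&0&\overline{\omega}&\overline{\omega}&0&1\\ 0&0&0&\omega&0&1&1&0&\omega\\ 0&0&0&0&1&1&\omega&1&1\\ 0&0&0&0&\omega&\omega&\overline{\omega}&\omega&\omega \end{pmatrix}. \] Let $\phi:GF(4)\to GF(2)^4$ be given by $\phi(0)=0000$, $\phi(1)=0011$, $\phi(\omega)=0101$, $\phi(\overline{\omega})=0110$, and for an additive code $C\subset GF(4)^m$ let $\phi(C)=\{(\phi(c_1),\dots,\phi(c_m)) : (c_1,\dots,c_m)\in C\}\subset GF(2)^{4m}$. Divide the coordinates of $GF(2)^{4m}$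 into $m$ consecutive blocks of length $4$. Let $B_m$ be the set of all sums of an even number of the vectors of weight $4$ whose ones fill exactly one block, and put $d_1=(1000\,1000\cdots 1000)$ and $d_2=(1000\cdots 1000\,0111)$ in $GF(2)^{4m}$. Let $d$ be the binary linear code generated by $B_m$ together with $d_1$ if $m$ is odd and $d_2$ if $m$ is even, and let $d'$ be the binary linear code generated by $B_m$ together with $d_1$ if $m$ is even and $d_2$ if $m$ is odd. Construction O is $\rho_O(C)=\phi(C)+d$ and Construction E is $\rho_E(C)=\phi(C)+d'$. Then $|C_4^9|=2^{10}$, and the codes $\mathcal{C}_O^{36}=\rho_O(C_4^9)$ and $\mathcal{C}_E^{36}=\rho_E(C_4^9)$ are binary linear $[36,19,8]$ codes (length $36$, dimension $19$, minimum distance exactly $8$). They are optimal: no binary linear code of length $36$ and dimension $19$ has minimum distance greater than $8$. Their weight distributions are different, and they are inequivalent, that is, no permutation of the $36$ coordinates maps one onto the other. -/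

import Mathlib

/-! Binary codes and their parameters. A binary code of length `n` is a set of vectors
`Fin n → ZMod 2`. -/

/-- `d` is the minimum distance of the binary code `C`: the least Hamming distance between two
distinct codewords. -/
def IsMinDist {n : ℕ} (C : Set (Fin n → ZMod 2)) (d : ℕ) : Prop :=
  IsLeast {w : ℕ | ∃ x ∈ C, ∃ y ∈ C, x ≠ y ∧ w = hammingDist x y} d

/-- `C` is a binary linear `[n, k, d]` code: a `k`-dimensional linear subspace of `GF(2)^n` with
minimum distance exactly `d`. -/
def IsLinearCode (n k d : ℕ) (C : Set (Fin n → ZMod 2)) : Prop :=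
  (∃ V : Submodule (ZMod 2) (Fin n → ZMod 2),
    (V : Set (Fin n → ZMod 2)) = C ∧ Module.finrank (ZMod 2) V = k) ∧
  IsMinDist C d

/-- `C` is an optimal binary linear `[n, k, d]` code: no binary linear code of the same length and
dimension has a larger minimum distance. -/
def IsOptimalLinearCode (n k d : ℕ) (C : Set (Fin n → ZMod 2)) : Prop :=
  IsLinearCode n k d C ∧
  ∀ d' : ℕ, d < d' → ∀ D : Set (Fin n → ZMod 2), ¬ IsLinearCode n k d' D

/-- The weight distribution `w ↦ A_w` of a binary code: `A_w` is the number of codewords of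
Hamming weight `w`. -/
noncomputable def weightDistribution {n : ℕ} (C : Set (Fin n → ZMod 2)) (w : ℕ) : ℕ :=
  {c ∈ C | hammingNorm c = w}.ncard

/-- Two binary codes of length `n` are equivalent if a permutation of the coordinates maps one
onto the other. -/
def CodeEquivalent {n : ℕ} (C D : Set (Fin n → ZMod 2)) : Prop :=
  ∃ σ : Equiv.Perm (Fin n), (fun c : Fin n → ZMod 2 => c ∘ σ) '' C = D

/-! The Constructions O and E. A vector of `GF(2)^{4m}` is a sequence of `m` blocks of length 4
(the columns of the associated `4 × m` array). -/

/-- The vector of `GF(2)^{4m}` with the given blocks `b 0, b 1, …, b (m - 1)`. -/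
def ofBlocks {m : ℕ} (b : Fin m → Fin 4 → ZMod 2) : Fin (m * 4) → ZMod 2 :=
  fun j => b j.divNat j.modNat

open Classical in
/-- The map `φ : GF(4) → GF(2)^4` with `0 ↦ 0000`, `1 ↦ 0011`, `ω ↦ 0101`, `ω̄ ↦ 0110`. -/
noncomputable def phi {F : Type*} [Field F] (ω : F) (x : F) : Fin 4 → ZMod 2 :=
  if x = 0 then ![0, 0, 0, 0]
  else if x = 1 then ![0, 0, 1, 1]
  else if x = ω then ![0, 1, 0, 1]
  else ![0, 1, 1, 0]

/-- `φ(C)`: the map `φ` applied to every coordinate of every codeword of `C`. -/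
def phiCode {F : Type*} [Field F] (ω : F) {m : ℕ} (C : AddSubgroup (Fin m → F)) :
    Set (Fin (m * 4) → ZMod 2) :=
  {v | ∃ c ∈ C, v = ofBlocks (fun i => phi ω (c i))}

/-- The weight 4 vector whose ones are exactly the entries of the `i`-th block. -/
def columnVec {m : ℕ} (i : Fin m) : Fin (m * 4) → ZMod 2 :=
  ofBlocks (fun j => if j = i then ![1, 1, 1, 1] else ![0, 0, 0, 0])

/-- All sums of an even number of the vectors `columnVec i`. -/
def evenSums (m : ℕ) : Set (Fin (m * 4) → ZMod 2) :=
  {v | ∃ S : Finset (Fin m), Even S.card ∧ v = ∑ i ∈ S, columnVec i}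

/-- The vector `d₁ = (1000 1000 … 1000)`. -/
def dOne (m : ℕ) : Fin (m * 4) → ZMod 2 :=
  ofBlocks (fun _ => ![1, 0, 0, 0])

/-- The vector `d₂ = (1000 1000 … 1000 0111)`. -/
def dTwo (m : ℕ) : Fin (m * 4) → ZMod 2 :=
  ofBlocks (fun i => if (i : ℕ) + 1 = m then ![0, 1, 1, 1] else ![1, 0, 0, 0])

open Classical in
/-- The code `d` of Construction O: generated by the even sums together with
`d₁` if `m` is odd and `d₂` if `m` is even. -/
noncomputable def dCodeO (m : ℕ) : Submodule (ZMod 2) (Fin (m * 4) → ZMod 2) :=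
  Submodule.span (ZMod 2) (evenSums m ∪ {if Odd m then dOne m else dTwo m})

open Classical in
/-- The code `d'` of Construction E: generated by the even sums together with
`d₁` if `m` is even and `d₂` if `m` is odd. -/
noncomputable def dCodeE (m : ℕ) : Submodule (ZMod 2) (Fin (m * 4) → ZMod 2) :=
  Submodule.span (ZMod 2) (evenSums m ∪ {if Even m then dOne m else dTwo m})

/-- Construction O: `ρ_O(C) = φ(C) + d`. -/
def rhoO {F : Type*} [Field F] (ω : F) {m : ℕ} (C : AddSubgroup (Fin m → F)) :
    Set (Fin (m * 4) → ZMod 2) :=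
  {v | ∃ a ∈ phiCode ω C, ∃ b ∈ dCodeO m, v = a + b}

/-- Construction E: `ρ_E(C) = φ(C) + d'`. -/
def rhoE {F : Type*} [Field F] (ω : F) {m : ℕ} (C : AddSubgroup (Fin m → F)) :
    Set (Fin (m * 4) → ZMod 2) :=
  {v | ∃ a ∈ phiCode ω C, ∃ b ∈ dCodeE m, v = a + b}

/-! The additive code `C_4^9` and the two binary codes built from it. -/

/-- The generator matrix of `C_4^9` (here `ω ^ 2 = ω̄`). -/
def genMatrix {F : Type*} [Field F] (ω : F) : Matrix (Fin 10) (Fin 9) F :=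
  !![1, 0, 0, 0, 0, ω ^ 2, 1, 1, 1;
     ω, 0, 0, 0, 0, 1, ω, ω, ω;
     0, 1, 0, 0, 0, 1, ω, ω ^ 2, 0;
     0, ω, 0, 0, 0, ω, ω ^ 2, 1, 0;
     0, 0, 1, 0, 0, 0, 1, ω, ω ^ 2;
     0, 0, ω, 0, 0, 0, ω, ω ^ 2, 1;
     0, 0, 0, 1, 0, ω ^ 2, ω ^ 2, 0, 1;
     0, 0, 0, ω, 0, 1, 1, 0, ω;
     0, 0, 0, 0, 1, 1, ω, 1, 1;
     0, 0, 0, 0, ω, ω, ω ^ 2, ω, ω]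

/-- The additive code `C_4^9`: all sums of rows of the generator matrix. -/
def additiveCode9 {F : Type*} [Field F] (ω : F) : AddSubgroup (Fin 9 → F) :=
  AddSubgroup.closure (Set.range (genMatrix ω).row)

/-- The binary code `C_O^36 = ρ_O(C_4^9)` (its length is `9 * 4 = 36`). -/
def codeO36 {F : Type*} [Field F] (ω : F) : Set (Fin 36 → ZMod 2) :=
  rhoO ω (additiveCode9 ω)

/-- The binary code `C_E^36 = ρ_E(C_4^9)` (its length is `9 * 4 = 36`). -/
def codeE36 {F : Type*} [Field F] (ω : F) : Set (Fin 36 → ZMod 2) :=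
  rhoE ω (additiveCode9 ω)

/-! Two independent arguments are combined.

Optimality. Suppose a [36,19] code has minimum weight at least 9, and restrict it to the zero
positions of a word w of minimum weight. This residual code has length 36 - wt(w), dimension 18 and
minimum weight at least 5. The columns of a parity check matrix, together with 0, then form a Sidon
set of 37 - wt(w) points in dimension 18 - wt(w). That is 28 points in dimension 9 if wt(w) = 9, and
at least 19 points in dimension at most 8 otherwise. Both are excluded by Fourier analysis. The
coefficients F(u) of a Sidon set have known second and fourth moments, are bounded through the sizes
of hyperplane slices, and are determined mod 4 by the sum of the set. A polynomial in F with
controlled sign on the remaining values, summed over u ≠ 0, gives the contradiction. The bounds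
climb through the dimensions: at most 12 points in dimension 7 (`IsSidon.card_le_twelve`), at most
18 in dimension 8 (`IsSidon.card_le_eighteen`), never 28 in dimension 9
(`IsSidon.card_ne_twentyEight`).

The two codes. Each word has coordinates (x, y, ε): a codeword of the additive code, a choice of
all-one blocks, and a multiple of 1000...1000. The two constructions differ only in the parity
condition Σ y = κε, with κ = 0 for O and κ = 1 for E. Words with ε = 0 have even weight, at least 8
unless zero, because the additive code has minimum weight 4. Words with ε = 1 have odd weight in
each of the nine blocks. Over each x exactly one y gives weight 9, and its parity is that of the
symbol weight of x. Hence A_9 counts the additive codewords of even weight (496) for O and of odd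
weight (528) for E. -/

/-! Sidon sets in elementary abelian 2-groups. -/

/-- The nontrivial sign character of `ZMod 2`. -/
def signChar (a : ZMod 2) : ℤ := if a = 0 then 1 else -1

theorem signChar_zero : signChar 0 = 1 := rfl

theorem signChar_add (a b : ZMod 2) : signChar (a + b) = signChar a * signChar b := by
  revert a b; unfold signChar; decide

theorem signChar_eq_one_or (a : ZMod 2) : signChar a = 1 ∨ signChar a = -1 := by
  unfold signChar; split_ifs <;> simp

theorem signChar_eq_neg_of_ne {a b : ZMod 2} (h : a ≠ b) : signChar a = - signChar b := by
  revert a b; unfold signChar; decide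

/-- A subset of an elementary abelian 2-group whose pairs of distinct elements have distinct
sums. -/
def IsSidon {V : Type*} [AddCommGroup V] (S : Finset V) : Prop :=
  ∀ a ∈ S, ∀ b ∈ S, ∀ c ∈ S, ∀ d ∈ S, a + b = c + d → a = b ∨ a = c ∨ a = d

theorem IsSidon.subset {V : Type*} [AddCommGroup V] {S T : Finset V} (hS : IsSidon S)
    (h : T ⊆ S) : IsSidon T :=
  fun a ha b hb c hc d hd => hS a (h ha) b (h hb) c (h hc) d (h hd)

/-! ### Fourier coefficients and moments of Sidon sets -/

section Fourier

variable {V : Type*} [AddCommGroup V]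

open Classical in
theorem IsSidon.image_add {S : Finset V} (hS : IsSidon S) (t : V) :
    IsSidon (S.image (· + t)) := by
  intro a ha b hb c hc d hd h
  simp only [Finset.mem_image] at ha hb hc hd
  obtain ⟨a, ha, rfl⟩ := ha
  obtain ⟨b, hb, rfl⟩ := hb
  obtain ⟨c, hc, rfl⟩ := hc
  obtain ⟨d, hd, rfl⟩ := hd
  have h' : a + b = c + d := by
    have := congrArg (· - (t + t)) h
    simpa [add_add_add_comm _ t _ t] using this
  simpa using hS a ha b hb c hc d hd h'

theorem IsSidon.image_of_injective {W : Type*} [AddCommGroup W] [DecidableEq W]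
    {S : Finset V} (hS : IsSidon S) (f : V →+ W) (hf : Function.Injective f) : IsSidon (S.image f) := by
  intro a ha b hb c hc d hd h
  simp only [Finset.mem_image] at ha hb hc hd
  obtain ⟨a, ha, rfl⟩ := ha
  obtain ⟨b, hb, rfl⟩ := hb
  obtain ⟨c, hc, rfl⟩ := hc
  obtain ⟨d, hd, rfl⟩ := hd
  rw [← map_add, ← map_add] at h
  simpa [hf.eq_iff] using hS a ha b hb c hc d hd (hf h)

open Classical in
/-- The number of representations of `x` as an ordered sum of two elements of `T`. -/
noncomputable def repCount (T : Finset V) (x : V) : ℕ :=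
  ((T ×ˢ T).filter (fun p => p.1 + p.2 = x)).card

theorem IsSidon.repCount_add {T : Finset V} (hT : IsSidon T) {a b : V} (ha : a ∈ T) (hb : b ∈ T)
    (hab : a ≠ b) : repCount T (a + b) = 2 := by
  classical
  have : (T ×ˢ T).filter (fun p => p.1 + p.2 = a + b) = {(a, b), (b, a)} := by
    ext ⟨c, d⟩
    simp only [Finset.mem_filter, Finset.mem_product, Finset.mem_insert, Finset.mem_singleton,
      Prod.mk.injEq]
    constructor
    · rintro ⟨⟨hc, hd⟩, h⟩
      rcases hT a ha b hb c hc d hd h.symm with h1 | rfl | rfl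
      · exact absurd h1 hab
      · exact Or.inl ⟨rfl, add_left_cancel h⟩
      · exact Or.inr ⟨by rw [add_comm] at h; exact add_left_cancel h, rfl⟩
    · rintro (⟨rfl, rfl⟩ | ⟨rfl, rfl⟩)
      · exact ⟨⟨ha, hb⟩, rfl⟩
      · exact ⟨⟨hb, ha⟩, add_comm _ _⟩
  rw [repCount, this, Finset.card_pair]
  simp [hab]

variable [Module (ZMod 2) V]

theorem add_eq_zero_iff_eq_of_two (a b : V) : a + b = 0 ↔ a = b := by
  rw [← ZModModule.sub_eq_add, sub_eq_zero]

/-- The Fourier coefficient of the indicator function of `S` at the character given by `u`. -/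
def charSum (S : Finset V) (u : Module.Dual (ZMod 2) V) : ℤ := ∑ s ∈ S, signChar (u s)

theorem charSum_zero (S : Finset V) : charSum S 0 = S.card := by
  simp [charSum, signChar_zero]

/-- If N elements of S have `u s = 1`, the coefficient is |S| - 2N, and the parity of N is the value
of u at the sum of S. -/
theorem four_dvd_charSum_sub (S : Finset V) (u : Module.Dual (ZMod 2) V) :
    (4 : ℤ) ∣ charSum S u - (S.card - 1 + signChar (u (∑ s ∈ S, s))) := by
  classical
  induction S using Finset.induction_on with
  | empty => simp [charSum, signChar_zero]
  | insert a S ha ih =>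
    have e : charSum (insert a S) u = signChar (u a) + charSum S u := by
      simp [charSum, Finset.sum_insert ha]
    rw [e, Finset.sum_insert ha, Finset.card_insert_of_notMem ha, map_add, signChar_add]
    push_cast
    rcases signChar_eq_one_or (u a) with h1 | h1 <;>
      rcases signChar_eq_one_or (u (∑ s ∈ S, s)) with h2 | h2 <;> simp only [h1, h2] at ih ⊢ <;> omega

theorem repCount_zero (T : Finset V) : repCount T 0 = T.card := by
  classical
  unfold repCount
  rw [← Finset.diag_card T]
  congr 1
  ext ⟨a, b⟩
  simp only [Finset.mem_filter, Finset.mem_product, Finset.mem_diag, add_eq_zero_iff_eq_of_two]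
  constructor
  · rintro ⟨⟨h, _⟩, rfl⟩; exact ⟨h, rfl⟩
  · rintro ⟨h, rfl⟩; exact ⟨⟨h, h⟩, rfl⟩

theorem IsSidon.repCount_eq {T : Finset V} (hT : IsSidon T) {x : V} (hx : x ≠ 0) :
    repCount T x = 0 ∨ repCount T x = 2 := by
  classical
  by_cases h : ∃ a ∈ T, ∃ b ∈ T, a + b = x
  · obtain ⟨a, ha, b, hb, rfl⟩ := h
    refine Or.inr (hT.repCount_add ha hb ?_)
    rintro rfl
    exact hx (ZModModule.add_self a)
  · left
    rw [repCount, Finset.card_eq_zero, Finset.filter_eq_empty_iff]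
    rintro ⟨a, b⟩ hp hab
    rw [Finset.mem_product] at hp
    exact h ⟨a, hp.1, b, hp.2, hab⟩

theorem exists_dual_apply_eq_one {u : Module.Dual (ZMod 2) V} (hu : u ≠ 0) : ∃ t, u t = 1 := by
  by_contra! h
  refine hu (LinearMap.ext fun x => ?_)
  have key : ∀ a : ZMod 2, a ≠ 1 → a = 0 := by decide
  exact key _ (h x)

variable [Finite V]

noncomputable instance dualFintype : Fintype (Module.Dual (ZMod 2) V) :=
  have : Finite (Module.Dual (ZMod 2) V) := DFunLike.finite _
  Fintype.ofFinite _

open Classical in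
theorem sum_signChar_dual (x : V) :
    ∑ u : Module.Dual (ZMod 2) V, signChar (u x)
      = if x = 0 then 2 ^ Module.finrank (ZMod 2) V else 0 := by
  split_ifs with hx
  · subst hx
    simp only [map_zero, signChar_zero, Finset.sum_const, Finset.card_univ, nsmul_eq_mul, mul_one]
    rw [Module.card_eq_pow_finrank (K := ZMod 2), Subspace.dual_finrank_eq, ZMod.card]
    norm_cast
  · obtain ⟨w, hw⟩ : ∃ w : Module.Dual (ZMod 2) V, w x ≠ 0 := by
      by_contra! h
      exact hx ((Module.forall_dual_apply_eq_zero_iff (ZMod 2) x).1 h)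
    have h1 : ∑ u : Module.Dual (ZMod 2) V, signChar (u x)
        = ∑ u : Module.Dual (ZMod 2) V, signChar ((u + w) x) :=
      (Equiv.sum_comp (Equiv.addRight w) (fun u => signChar (u x))).symm
    have h2 : ∀ u : Module.Dual (ZMod 2) V, signChar ((u + w) x) = - signChar (u x) := fun u => by
      rw [LinearMap.add_apply, signChar_add, signChar, signChar, if_neg hw]; ring
    simp only [h2, Finset.sum_neg_distrib] at h1
    omega

theorem sum_signChar_mul_charSum_sq (T : Finset V) (x : V) :
    ∑ u : Module.Dual (ZMod 2) V, signChar (u x) * charSum T u ^ 2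
      = 2 ^ Module.finrank (ZMod 2) V * repCount T x := by
  classical
  have h1 : ∀ u : Module.Dual (ZMod 2) V, signChar (u x) * charSum T u ^ 2
      = ∑ p ∈ T ×ˢ T, signChar (u (p.1 + p.2 + x)) := fun u => by
    rw [sq, charSum, Finset.sum_mul_sum, ← Finset.sum_product', Finset.mul_sum]
    refine Finset.sum_congr rfl fun p _ => ?_
    rw [map_add, map_add, signChar_add, signChar_add]; ring
  simp only [h1]
  rw [Finset.sum_comm]
  simp only [sum_signChar_dual, add_eq_zero_iff_eq_of_two]
  rw [← Finset.sum_filter, Finset.sum_const, repCount, nsmul_eq_mul, mul_comm]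

theorem sum_signChar (x : V) (hx : x ≠ 0) :
    ∑ u : Module.Dual (ZMod 2) V, signChar (u x) = 0 := by
  classical
  rw [sum_signChar_dual, if_neg hx]

theorem sum_charSum_sq (T : Finset V) :
    ∑ u : Module.Dual (ZMod 2) V, charSum T u ^ 2
      = 2 ^ Module.finrank (ZMod 2) V * T.card := by
  have := sum_signChar_mul_charSum_sq T 0
  simpa [signChar_zero, repCount_zero] using this

theorem sum_charSum (T : Finset V) [Decidable ((0 : V) ∈ T)] :
    ∑ u : Module.Dual (ZMod 2) V, charSum T u
      = 2 ^ Module.finrank (ZMod 2) V * (if (0 : V) ∈ T then 1 else 0) := by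
  classical
  simp only [charSum]
  rw [Finset.sum_comm]
  simp only [sum_signChar_dual]
  simp

theorem sum_charSum_cube (T : Finset V) :
    ∑ u : Module.Dual (ZMod 2) V, charSum T u ^ 3
      = 2 ^ Module.finrank (ZMod 2) V * ∑ a ∈ T, (repCount T a : ℤ) := by
  have h1 : ∀ u : Module.Dual (ZMod 2) V, charSum T u ^ 3
      = ∑ a ∈ T, signChar (u a) * charSum T u ^ 2 := fun u => by
    rw [← Finset.sum_mul, pow_succ' _ 2]; rfl
  simp only [h1]
  rw [Finset.sum_comm, Finset.mul_sum]
  exact Finset.sum_congr rfl fun a _ => sum_signChar_mul_charSum_sq T a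

theorem sum_charSum_sq_mul_sq (S T : Finset V) :
    ∑ u : Module.Dual (ZMod 2) V, charSum S u ^ 2 * charSum T u ^ 2
      = 2 ^ Module.finrank (ZMod 2) V * ∑ a ∈ S, ∑ b ∈ S, (repCount T (a + b) : ℤ) := by
  have h1 : ∀ u : Module.Dual (ZMod 2) V, charSum S u ^ 2 * charSum T u ^ 2
      = ∑ a ∈ S, ∑ b ∈ S, signChar (u (a + b)) * charSum T u ^ 2 := fun u => by
    simp only [← Finset.sum_mul, map_add, signChar_add]
    rw [← Finset.sum_mul_sum, ← sq]; rfl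
  simp only [h1]
  rw [Finset.sum_comm, Finset.mul_sum]
  refine Finset.sum_congr rfl fun a _ => ?_
  rw [Finset.sum_comm, Finset.mul_sum]
  exact Finset.sum_congr rfl fun b _ => sum_signChar_mul_charSum_sq T _

/-- For fixed a in S, the sum a + b has |S| representations when b = a and exactly two for each of
the |S| - 1 other b. -/
theorem IsSidon.sum_charSum_pow_four {S : Finset V} (hS : IsSidon S) :
    ∑ u : Module.Dual (ZMod 2) V, charSum S u ^ 4
      = 2 ^ Module.finrank (ZMod 2) V * (3 * (S.card : ℤ) ^ 2 - 2 * S.card) := by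
  classical
  have h1 : ∀ u : Module.Dual (ZMod 2) V,
      charSum S u ^ 4 = charSum S u ^ 2 * charSum S u ^ 2 := fun u => by ring
  simp only [h1, sum_charSum_sq_mul_sq]
  congr 1
  have h2 : ∀ a ∈ S, ∑ b ∈ S, (repCount S (a + b) : ℤ) = 3 * S.card - 2 := fun a ha => by
    rw [← Finset.add_sum_erase S _ ha, ZModModule.add_self, repCount_zero,
      Finset.sum_congr rfl (g := fun _ => (2 : ℤ))]
    · rw [Finset.sum_const, Finset.card_erase_of_mem ha, nsmul_eq_mul,
        Nat.cast_sub (Finset.card_pos.2 ⟨a, ha⟩)]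
      push_cast; ring
    · intro b hb
      rw [Finset.mem_erase] at hb
      rw [hS.repCount_add ha hb.2 hb.1.symm]; rfl
  rw [Finset.sum_congr rfl h2, Finset.sum_const, nsmul_eq_mul]; ring

/-- Only the diagonal a = b contributes. The hypothesis is what the Sidon property gives for the
slices of one Sidon set by two parallel hyperplanes. -/
theorem sum_charSum_sq_mul_sq_of_disjoint {S T : Finset V}
    (h : ∀ a ∈ S, ∀ b ∈ S, ∀ c ∈ T, ∀ d ∈ T, a + b = c + d → a = b) :
    ∑ u : Module.Dual (ZMod 2) V, charSum S u ^ 2 * charSum T u ^ 2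
      = 2 ^ Module.finrank (ZMod 2) V * (S.card * T.card) := by
  classical
  rw [sum_charSum_sq_mul_sq]
  congr 1
  have h2 : ∀ a ∈ S, ∑ b ∈ S, (repCount T (a + b) : ℤ) = T.card := fun a ha => by
    rw [← Finset.add_sum_erase S _ ha, ZModModule.add_self, repCount_zero, Finset.sum_eq_zero,
      add_zero]
    intro b hb
    rw [Finset.mem_erase] at hb
    rw [repCount, Nat.cast_eq_zero, Finset.card_eq_zero, Finset.filter_eq_empty_iff]
    rintro ⟨c, d⟩ hp hcd
    rw [Finset.mem_product] at hp
    exact hb.1 (h a ha b hb.2 c hp.1 d hp.2 hcd.symm).symm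
  rw [Finset.sum_congr rfl h2, Finset.sum_const, nsmul_eq_mul]

open Classical in
/-- The part of `S` in the coset `t + ker u`, translated into `ker u`. -/
noncomputable def slice (S : Finset V) (u : Module.Dual (ZMod 2) V) (t : V) :
    Finset (LinearMap.ker u) :=
  have : Fintype (LinearMap.ker u) := Fintype.ofFinite _
  Finset.univ.filter (fun x => (x : V) + t ∈ S)

theorem mem_slice {S : Finset V} {u : Module.Dual (ZMod 2) V} {t : V} {x : LinearMap.ker u} :
    x ∈ slice S u t ↔ (x : V) + t ∈ S := by
  simp [slice]

theorem isSidon_slice {S : Finset V} (hS : IsSidon S) (u : Module.Dual (ZMod 2) V) (t : V) :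
    IsSidon (slice S u t) := by
  intro a ha b hb c hc d hd h
  have h' : (a : V) + t + (b + t) = c + t + (d + t) := by
    rw [add_add_add_comm, add_add_add_comm (c : V), ← Submodule.coe_add, ← Submodule.coe_add, h]
  simpa using hS _ (mem_slice.1 ha) _ (mem_slice.1 hb) _ (mem_slice.1 hc) _ (mem_slice.1 hd) h'

theorem sum_slice (S : Finset V) (u : Module.Dual (ZMod 2) V) (t : V) (f : V → ℤ) :
    ∑ x ∈ slice S u t, f (x + t) = ∑ s ∈ S.filter (fun s => u s = u t), f s := by
  refine Finset.sum_bij (fun x _ => (x : V) + t) ?_ ?_ ?_ ?_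
  · intro x hx
    rw [Finset.mem_filter]
    refine ⟨mem_slice.1 hx, ?_⟩
    rw [map_add, LinearMap.mem_ker.1 x.2, zero_add]
  · intro x _ y _ h
    exact Subtype.ext (add_right_cancel h)
  · intro s hs
    rw [Finset.mem_filter] at hs
    refine ⟨⟨s - t, ?_⟩, ?_, ?_⟩
    · rw [LinearMap.mem_ker, map_sub, hs.2, sub_self]
    · rw [mem_slice]; simpa using hs.1
    · simp
  · intros; rfl

theorem sum_filter_signChar (S : Finset V) (u w : Module.Dual (ZMod 2) V) (t : V) :
    ∑ s ∈ S.filter (fun s => u s = u t), signChar (w s)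
      = signChar (w t) * charSum (slice S u t) (w.comp (LinearMap.ker u).subtype) := by
  rw [← sum_slice S u t (fun s => signChar (w s)), charSum, Finset.mul_sum]
  refine Finset.sum_congr rfl fun x _ => ?_
  rw [map_add, signChar_add, mul_comm]; rfl

theorem charSum_eq_slices (S : Finset V) (u w : Module.Dual (ZMod 2) V) {a b : V}
    (hab : u a ≠ u b) :
    charSum S w = signChar (w a) * charSum (slice S u a) (w.comp (LinearMap.ker u).subtype)
      + signChar (w b) * charSum (slice S u b) (w.comp (LinearMap.ker u).subtype) := by
  rw [← sum_filter_signChar, ← sum_filter_signChar, charSum,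
    ← Finset.sum_filter_add_sum_filter_not S (fun s => u s = u a)]
  congr 2
  refine Finset.filter_congr fun s _ => ?_
  have key : ∀ x y z : ZMod 2, y ≠ z → (¬ x = y ↔ x = z) := by decide
  exact key _ _ _ hab

theorem card_eq_card_slices (S : Finset V) (u : Module.Dual (ZMod 2) V) {a b : V}
    (hab : u a ≠ u b) : (S.card : ℤ) = (slice S u a).card + (slice S u b).card := by
  have := charSum_eq_slices S u 0 hab
  simpa [charSum_zero, signChar_zero] using this

theorem charSum_self_eq_card_slices (S : Finset V) (u : Module.Dual (ZMod 2) V) {a b : V}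
    (ha : u a = 0) (hb : u b = 1) :
    charSum S u = (slice S u a).card - (slice S u b).card := by
  have h0 : u.comp (LinearMap.ker u).subtype = 0 := by ext x; exact x.2
  rw [charSum_eq_slices S u u (a := a) (b := b) (by rw [ha, hb]; decide), h0, charSum_zero,
    charSum_zero, ha, hb]
  simp [signChar]; ring

theorem finrank_ker_dual {u : Module.Dual (ZMod 2) V} (hu : u ≠ 0) {r : ℕ}
    (hr : Module.finrank (ZMod 2) V = r + 1) :
    Module.finrank (ZMod 2) (LinearMap.ker u) = r := by
  have := Module.Dual.finrank_ker_add_one_of_ne_zero hu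
  omega

/-- The coefficient is the difference of the sizes of the two slices. These sizes add up to |S| and
are both at most M. -/
theorem abs_charSum_le {S : Finset V} (hS : IsSidon S) {u : Module.Dual (ZMod 2) V} (hu : u ≠ 0)
    {M : ℕ} (hM : ∀ T : Finset (LinearMap.ker u), IsSidon T → T.card ≤ M) :
    |charSum S u| ≤ 2 * M - S.card := by
  obtain ⟨t, ht⟩ := exists_dual_apply_eq_one hu
  have h0 := hM _ (isSidon_slice hS u 0)
  have h1 := hM _ (isSidon_slice hS u t)
  rw [card_eq_card_slices S u (a := 0) (b := t) (by rw [map_zero, ht]; decide),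
    charSum_self_eq_card_slices S u (a := 0) (b := t) (map_zero u) ht, abs_le]
  constructor <;> linarith [(Nat.cast_le (α := ℤ)).2 h0, (Nat.cast_le (α := ℤ)).2 h1]

end Fourier

/-! ### Sidon sets in dimensions 7, 8 and 9 -/

section SidonBounds

variable {V : Type*} [AddCommGroup V] [Module (ZMod 2) V]

/-- In a Sidon set without `0`, the elements lying in some triple with sum zero are partitioned
by these triples. -/
theorem IsSidon.sum_filter_repCount {S : Finset V} (hS : IsSidon S) (h0 : (0 : V) ∉ S) :
    ∑ a ∈ S.filter (fun a => repCount S a = 2), a = 0 ∧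
      3 ∣ (S.filter (fun a => repCount S a = 2)).card := by
  classical
  set S' := S.filter (fun a => repCount S a = 2) with hS'
  -- For a in some zero-sum triple, `h a` is that triple. The Sidon property makes it unique, so the
  -- fibres of `h` on `S'` are the triples.
  let h : V → Finset V := fun a => insert a (S.filter (fun b => a + b ∈ S))
  have ne_of : ∀ a ∈ S, ∀ b ∈ S, a + b ∈ S → a ≠ b := by
    rintro a ha b hb hab rfl
    rw [ZModModule.add_self] at hab
    exact h0 hab
  have h_eq : ∀ a ∈ S, ∀ b ∈ S, a + b ∈ S → h a = {a, b, a + b} := by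
    intro a ha b hb hab
    have hne : b ≠ a + b := fun e => h0 (by
      have : a = 0 := by simpa using e.symm
      exact this ▸ ha)
    simp only [h]
    congr 1
    ext x
    simp only [Finset.mem_filter, Finset.mem_insert, Finset.mem_singleton]
    constructor
    · rintro ⟨hx, hax⟩
      have e : b + (a + b) = x + (a + x) := by
        rw [add_left_comm, ZModModule.add_self, add_left_comm, ZModModule.add_self]
      rcases hS b hb _ hab x hx _ hax e with h1 | h1 | h1
      · exact absurd h1 hne
      · exact Or.inl h1.symm
      · exact Or.inr (by rw [h1, ← add_assoc, ZModModule.add_self, zero_add])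
    · rintro (rfl | rfl)
      · exact ⟨hb, hab⟩
      · exact ⟨hab, by rwa [← add_assoc, ZModModule.add_self, zero_add]⟩
  have mem_S' : ∀ a ∈ S, ∀ b ∈ S, a + b ∈ S → a + b ∈ S' := fun a ha b hb hab =>
    Finset.mem_filter.2 ⟨hab, hS.repCount_add ha hb (ne_of a ha b hb hab)⟩
  have fiber : ∀ a ∈ S', ∃ b, (S'.filter (fun x => h x = h a) = {a, b, a + b}) ∧
      a ≠ b ∧ a ≠ a + b ∧ b ≠ a + b := by
    intro a ha
    obtain ⟨haS, har⟩ := Finset.mem_filter.1 ha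
    obtain ⟨⟨c, b⟩, hp⟩ : ((S ×ˢ S).filter (fun p => p.1 + p.2 = a)).Nonempty := by
      rw [← Finset.card_pos]; change 0 < repCount S a; omega
    rw [Finset.mem_filter, Finset.mem_product] at hp
    obtain ⟨⟨hc, hb⟩, rfl⟩ := hp
    dsimp only at hc hb haS har ha
    have hcb : (c + b) + b = c := by rw [add_assoc, ZModModule.add_self, add_zero]
    refine ⟨b, ?_, ?_, ?_, ?_⟩
    · have e1 := h_eq (c + b) haS b hb (by rwa [hcb])
      have e2 := h_eq c hc b hb haS
      have e3 := h_eq b hb c hc (by rwa [add_comm])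
      have hcS : c ∈ S' := by
        have := mem_S' (c + b) haS b hb (by rwa [hcb]); rwa [hcb] at this
      have hbS : b ∈ S' := by
        have := mem_S' (c + b) haS c hc (by
          rwa [add_comm c, add_assoc, ZModModule.add_self, add_zero])
        rwa [add_comm c, add_assoc, ZModModule.add_self, add_zero] at this
      rw [hcb] at e1
      rw [e1, hcb]
      ext x
      rw [Finset.mem_filter]
      constructor
      · rintro ⟨_, hx⟩
        rw [← hx]; exact Finset.mem_insert_self _ _
      · intro hx
        simp only [Finset.mem_insert, Finset.mem_singleton] at hx
        rcases hx with rfl | rfl | rfl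
        · exact ⟨ha, e1⟩
        · refine ⟨hbS, ?_⟩
          rw [e3, add_comm]; ext y; simp only [Finset.mem_insert, Finset.mem_singleton]; tauto
        · refine ⟨hcS, ?_⟩
          rw [e2]; ext y; simp only [Finset.mem_insert, Finset.mem_singleton]; tauto
    · rintro e; exact h0 ((by simpa using e : c = 0) ▸ hc)
    · rintro e; exact h0 ((by simpa using e : b = 0) ▸ hb)
    · rw [hcb]; exact (ne_of c hc b hb haS).symm
  constructor
  · rw [← Finset.sum_fiberwise_of_maps_to (t := S'.image h) (g := h)
      (fun x hx => Finset.mem_image_of_mem h hx)]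
    refine Finset.sum_eq_zero fun B hB => ?_
    obtain ⟨a, ha, rfl⟩ := Finset.mem_image.1 hB
    obtain ⟨b, hb, h1, h2, h3⟩ := fiber a ha
    rw [hb, Finset.sum_insert (by simp [h1]; simpa using h2), Finset.sum_pair h3, ← add_assoc,
      ZModModule.add_self]
  · rw [Finset.card_eq_sum_card_fiberwise (t := S'.image h) (f := h)
      (fun x hx => Finset.mem_image_of_mem h hx)]
    refine Finset.dvd_sum fun B hB => ?_
    obtain ⟨a, ha, rfl⟩ := Finset.mem_image.1 hB
    obtain ⟨b, hb, h1, h2, h3⟩ := fiber a ha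
    rw [hb, Finset.card_eq_three.2 ⟨a, b, a + b, h1, h2, h3, rfl⟩]

theorem IsSidon.sum_repCount_of_zero_mem {S : Finset V} (hS : IsSidon S) (h0 : (0 : V) ∈ S) :
    ∑ a ∈ S, (repCount S a : ℤ) = 3 * S.card - 2 := by
  classical
  rw [← Finset.add_sum_erase S _ h0, repCount_zero, Finset.sum_congr rfl (g := fun _ => (2 : ℤ))]
  · rw [Finset.sum_const, Finset.card_erase_of_mem h0, nsmul_eq_mul,
      Nat.cast_sub (Finset.card_pos.2 ⟨0, h0⟩)]
    push_cast; ring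
  · intro a ha
    rw [Finset.mem_erase] at ha
    have := hS.repCount_add ha.2 h0 ha.1
    rw [add_zero] at this
    rw [this]; rfl

theorem IsSidon.sum_repCount_of_zero_notMem {S : Finset V} (hS : IsSidon S) (h0 : (0 : V) ∉ S) :
    ∑ a ∈ S, repCount S a = 2 * (S.filter (fun a => repCount S a = 2)).card := by
  classical
  rw [Finset.sum_congr rfl (g := fun a => if repCount S a = 2 then 2 else 0), ← Finset.sum_filter,
    Finset.sum_const, smul_eq_mul, mul_comm]
  intro a ha
  rcases hS.repCount_eq (x := a) (fun e => h0 (e ▸ ha)) with h | h <;> simp [h]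

theorem IsSidon.repCount_le_two {S : Finset V} (hS : IsSidon S) {x : V} (hx : x ≠ 0) :
    repCount S x ≤ 2 := by
  rcases hS.repCount_eq hx with h | h <;> omega

variable [Finite V]

/-- Every coefficient is 1 mod 4. The quartic used is (F + 7)(F + 3)(F - 1)(F - 5), which at F = 4k
+ 1 is 256 times a product of four consecutive integers, hence nonnegative. Summation over u ≠ 0
bounds the third moment from below, and this moment counts zero-sum triples. -/
theorem not_isSidon_thirteen_of_sum_eq_zero (hV : Module.finrank (ZMod 2) V = 7) {S : Finset V}
    (hc : S.card = 13) (hs : ∑ s ∈ S, s = 0) : ¬ IsSidon S := by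
  classical
  intro hS
  have pt : ∀ u : Module.Dual (ZMod 2) V, 0 ≤ charSum S u ^ 4 + 4 * charSum S u ^ 3
      - 34 * charSum S u ^ 2 - 76 * charSum S u + 105 := by
    intro u
    have h4 := four_dvd_charSum_sub S u
    rw [hs, map_zero, signChar_zero, hc] at h4
    obtain ⟨k, hk⟩ : ∃ k, charSum S u = 4 * k + 1 := ⟨(charSum S u - 1) / 4, by omega⟩
    rw [hk]
    have e : (4 * k + 1) ^ 4 + 4 * (4 * k + 1) ^ 3 - 34 * (4 * k + 1) ^ 2 - 76 * (4 * k + 1) + 105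
        = 256 * ((k ^ 2 + k - 1) ^ 2 - 1) := by ring
    rw [e]
    have h1 : k ^ 2 + k - 1 ≤ -1 ∨ 1 ≤ k ^ 2 + k - 1 := by
      rcases le_or_gt k (-2) with h | h
      · right; nlinarith
      · rcases le_or_gt k 0 with h' | h'
        · left; nlinarith
        · right; nlinarith
    rcases h1 with h1 | h1 <;> nlinarith
  have tot := Finset.sum_nonneg (s := Finset.univ.erase (0 : Module.Dual (ZMod 2) V))
    (fun u _ => pt u)
  rw [Finset.sum_erase_eq_sub (Finset.mem_univ _)] at tot
  simp only [Finset.sum_add_distrib, Finset.sum_sub_distrib, ← Finset.mul_sum, charSum_zero,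
    sum_charSum_sq, sum_charSum_cube, sum_charSum, hS.sum_charSum_pow_four, hV, hc,
    Finset.sum_const, Finset.card_univ, Module.card_eq_pow_finrank (K := ZMod 2)
      (V := Module.Dual (ZMod 2) V), Subspace.dual_finrank_eq, ZMod.card] at tot
  norm_num at tot
  by_cases h0 : (0 : V) ∈ S
  · rw [hS.sum_repCount_of_zero_mem h0, hc, if_pos h0] at tot
    norm_num at tot
  · rw [if_neg h0] at tot
    have h1 := hS.sum_repCount_of_zero_notMem h0
    obtain ⟨h2, h3⟩ := hS.sum_filter_repCount h0
    have h4 := Finset.card_filter_le S (fun a => repCount S a = 2)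
    -- At least 12 of the 13 elements lie in disjoint zero-sum triples, so exactly 12 by
    -- divisibility by 3. Since the whole set sums to zero, the leftover element is 0.
    have h5 : (24 : ℤ) ≤ ∑ a ∈ S, (repCount S a : ℤ) := by linarith
    rw [← Nat.cast_sum] at h5
    have h6 := Finset.sum_filter_add_sum_filter_not S (fun a => repCount S a = 2) (fun a => a)
    have h7 := Finset.card_filter_add_card_filter_not (s := S) (fun a => repCount S a = 2)
    rw [h2, zero_add, hs] at h6
    have h8 : (S.filter (fun a => ¬ repCount S a = 2)).card = 1 := by omega
    obtain ⟨a, ha⟩ := Finset.card_eq_one.1 h8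
    rw [ha, Finset.sum_singleton] at h6
    have : a ∈ S := (Finset.mem_filter.1 (ha ▸ Finset.mem_singleton_self a)).1
    exact h0 (h6 ▸ this)

/-- As 13 is odd, translating 13 points by their sum makes the new sum zero. -/
theorem IsSidon.card_le_twelve (hV : Module.finrank (ZMod 2) V = 7) {S : Finset V}
    (hS : IsSidon S) : S.card ≤ 12 := by
  classical
  by_contra! h
  obtain ⟨T, hT, hc⟩ := Finset.exists_subset_card_eq (show 13 ≤ S.card from h)
  have hinj : Function.Injective (· + ∑ s ∈ T, s) := add_left_injective _
  refine not_isSidon_thirteen_of_sum_eq_zero hV (S := T.image (· + ∑ s ∈ T, s)) ?_ ?_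
    ((hS.subset hT).image_add _)
  · rw [Finset.card_image_of_injective _ hinj, hc]
  · rw [Finset.sum_image hinj.injOn, Finset.sum_add_distrib, Finset.sum_const, hc,
      show (13 : ℕ) = 6 * 2 + 1 from rfl, add_smul, mul_smul, two_smul, ZModModule.add_self,
      smul_zero, zero_add, one_smul, ZModModule.add_self]

theorem IsSidon.abs_charSum_le_six (hV : Module.finrank (ZMod 2) V = 8) {S : Finset V}
    (hS : IsSidon S) (hc : S.card = 18) {u : Module.Dual (ZMod 2) V} (hu : u ≠ 0) :
    |charSum S u| ≤ 6 := by
  have := abs_charSum_le hS hu (M := 12)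
    (fun T hT => IsSidon.card_le_twelve (finrank_ker_dual hu hV) hT)
  rw [hc] at this
  norm_num at this
  exact this

theorem IsSidon.sum_eq_zero_of_card_eq_eighteen (hV : Module.finrank (ZMod 2) V = 8)
    {S : Finset V} (hS : IsSidon S) (hc : S.card = 18) : ∑ s ∈ S, s = 0 := by
  classical
  by_contra hz
  set z := ∑ s ∈ S, s with hz'
  -- Where the sign at z is 1, F is ±2 or ±6 and the expression is (F² - 4)(F² - 36). Where it is
  -- -1, F is 0 or ±4 and the expression is F²(F² - 16). The moments then force `repCount S z = 12`,
  -- while a Sidon set allows at most 2.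
  have pt : ∀ u ∈ Finset.univ.erase (0 : Module.Dual (ZMod 2) V),
      charSum S u ^ 4 - 40 * charSum S u ^ 2 + 144 - 72 + 72 * signChar (u z)
        + 12 * charSum S u ^ 2 - 12 * (signChar (u z) * charSum S u ^ 2) = 0 := by
    intro u hu
    have h4 := four_dvd_charSum_sub S u
    rw [← hz', hc] at h4
    have h6 := abs_le.1 (hS.abs_charSum_le_six hV hc (Finset.ne_of_mem_erase hu))
    generalize charSum S u = F at *
    obtain ⟨h5, h6⟩ := h6
    rcases signChar_eq_one_or (u z) with h | h <;> rw [h] at h4 ⊢ <;> interval_cases F <;>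
      omega
  have tot := Finset.sum_eq_zero pt
  rw [Finset.sum_erase_eq_sub (Finset.mem_univ _)] at tot
  simp only [Finset.sum_add_distrib, Finset.sum_sub_distrib, ← Finset.mul_sum, charSum_zero,
    sum_charSum_sq, hS.sum_charSum_pow_four, sum_signChar_mul_charSum_sq, sum_signChar z hz, hV, hc,
    Finset.sum_const, Finset.card_univ, Module.card_eq_pow_finrank (K := ZMod 2)
      (V := Module.Dual (ZMod 2) V), Subspace.dual_finrank_eq, ZMod.card, LinearMap.zero_apply,
    signChar_zero] at tot
  norm_num at tot
  have := hS.repCount_le_two hz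
  omega

/-- In a set of 19 points, deleting any one of them leaves sum zero, so every point equals the total
sum. -/
theorem IsSidon.card_le_eighteen (hV : Module.finrank (ZMod 2) V = 8) {S : Finset V}
    (hS : IsSidon S) : S.card ≤ 18 := by
  classical
  by_contra! h
  obtain ⟨T, hT, hc⟩ := Finset.exists_subset_card_eq (show 19 ≤ S.card from h)
  have key : ∀ a ∈ T, a = ∑ s ∈ T, s := fun a ha => by
    have := IsSidon.sum_eq_zero_of_card_eq_eighteen hV
      ((hS.subset hT).subset (Finset.erase_subset a T)) (by rw [Finset.card_erase_of_mem ha, hc])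
    rw [← Finset.add_sum_erase T _ ha, this, add_zero]
  have : T.card ≤ 1 := Finset.card_le_one.2 fun a ha b hb => (key a ha).trans (key b hb).symm
  omega

/-- With F, G the coefficients of A, B and χ the sign at the sum z of B, the test function is 4(16 -
G²)(1 - χ) + (F² - 4)(G² - 4). Here F is ±2 or ±6, and G is 2 mod 4 or 0 mod 4 according to χ. The
bound |F| + |G| ≤ 8 then leaves only nonnegative values, but the moments make the sum over u ≠ 0
negative. -/
theorem not_isSidon_slices (hV : Module.finrank (ZMod 2) V = 8) {A B : Finset V}
    (hA : IsSidon A) (hB : IsSidon B) (hAc : A.card = 18) (hBc : B.card = 10)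
    (hcross : ∀ a ∈ A, ∀ b ∈ A, ∀ c ∈ B, ∀ d ∈ B, a + b = c + d → a = b)
    (hbound : ∀ u : Module.Dual (ZMod 2) V, u ≠ 0 → |charSum A u| + |charSum B u| ≤ 8) :
    False := by
  classical
  set z := ∑ s ∈ B, s with hz'
  have hA0 := hA.sum_eq_zero_of_card_eq_eighteen hV hAc
  have pt : ∀ u ∈ Finset.univ.erase (0 : Module.Dual (ZMod 2) V),
      0 ≤ 4 * (16 - charSum B u ^ 2 - 16 * signChar (u z) + signChar (u z) * charSum B u ^ 2)
        - (4 * charSum A u ^ 2 - charSum A u ^ 2 * charSum B u ^ 2 - 16 + 4 * charSum B u ^ 2) := by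
    intro u hu
    have h4 := four_dvd_charSum_sub B u
    have h5 := four_dvd_charSum_sub A u
    rw [← hz', hBc] at h4
    rw [hA0, hAc, map_zero, signChar_zero] at h5
    have hu := Finset.ne_of_mem_erase hu
    have h6 := abs_le.1 (hA.abs_charSum_le_six hV hAc hu)
    have h7 := hbound u hu
    generalize charSum A u = F at *
    generalize charSum B u = G at *
    have h8 : F = 6 ∨ F = 2 ∨ F = -2 ∨ F = -6 := by omega
    have h9 : |F| = 6 ∧ F ^ 2 = 36 ∨ |F| = 2 ∧ F ^ 2 = 4 := by
      rcases h8 with h | h | h | h <;> subst h <;> norm_num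
    clear h5 h6 h8
    rcases h9 with ⟨h, h'⟩ | ⟨h, h'⟩ <;> rw [h] at h7 <;> rw [h'] <;> clear h h'
    · obtain ⟨h10, h11⟩ := abs_le.1 (show |G| ≤ 2 by linarith)
      rcases signChar_eq_one_or (u z) with h | h <;> rw [h] at h4 ⊢ <;> interval_cases G <;> omega
    · obtain ⟨h10, h11⟩ := abs_le.1 (show |G| ≤ 6 by linarith)
      rcases signChar_eq_one_or (u z) with h | h <;> rw [h] at h4 ⊢ <;> interval_cases G <;> omega
  have tot := Finset.sum_nonneg pt
  rw [Finset.sum_erase_eq_sub (Finset.mem_univ _)] at tot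
  simp only [Finset.sum_add_distrib, Finset.sum_sub_distrib, ← Finset.mul_sum, charSum_zero,
    sum_charSum_sq, sum_signChar_mul_charSum_sq, sum_charSum_sq_mul_sq_of_disjoint hcross,
    sum_signChar_dual, hV, hAc, hBc,
    Finset.sum_const, Finset.card_univ, Module.card_eq_pow_finrank (K := ZMod 2)
      (V := Module.Dual (ZMod 2) V), Subspace.dual_finrank_eq, ZMod.card, LinearMap.zero_apply,
    signChar_zero] at tot
  by_cases hz : z = 0
  · rw [if_pos hz, hz, repCount_zero, hBc] at tot
    norm_num at tot
  · rw [if_neg hz] at tot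
    have := hB.repCount_le_two hz
    norm_num at tot
    omega

theorem IsSidon.card_ne_twentyEight (hV : Module.finrank (ZMod 2) V = 9) {S : Finset V}
    (hS : IsSidon S) : S.card ≠ 28 := by
  classical
  intro hc
  have bound : ∀ u : Module.Dual (ZMod 2) V, u ≠ 0 → |charSum S u| ≤ 8 := fun u hu => by
    have := abs_charSum_le hS hu (M := 18)
      (fun T hT => IsSidon.card_le_eighteen (finrank_ker_dual hu hV) hT)
    rw [hc] at this
    norm_num at this
    exact this
  -- If all |F| ≤ 6, then 36F² - F⁴ is nonnegative for u ≠ 0, yet the moments give these terms the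
  -- sum -73024.
  obtain ⟨u, hu, h8⟩ : ∃ u : Module.Dual (ZMod 2) V, u ≠ 0 ∧ 6 < |charSum S u| := by
    by_contra! h
    have pt : ∀ u ∈ Finset.univ.erase (0 : Module.Dual (ZMod 2) V),
        0 ≤ 36 * charSum S u ^ 2 - charSum S u ^ 4 := fun u hu => by
      have h1 : charSum S u ^ 2 ≤ 6 ^ 2 := sq_le_sq' (abs_le.1 (h u (Finset.ne_of_mem_erase hu))).1
        (abs_le.1 (h u (Finset.ne_of_mem_erase hu))).2
      nlinarith [sq_nonneg (charSum S u)]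
    have tot := Finset.sum_nonneg pt
    rw [Finset.sum_erase_eq_sub (Finset.mem_univ _)] at tot
    simp only [Finset.sum_sub_distrib, ← Finset.mul_sum, charSum_zero, sum_charSum_sq,
      hS.sum_charSum_pow_four, hV, hc] at tot
    norm_num at tot
  obtain ⟨t, ht⟩ := exists_dual_apply_eq_one hu
  -- The slice sizes add up to 28, so their difference is even. It lies above 6 and is at most 8,
  -- hence is 8.
  obtain ⟨a, b, hab, ha, hb⟩ : ∃ a b, u a ≠ u b ∧ (slice S u a).card = 18 ∧
      (slice S u b).card = 10 := by
    have e0 := card_eq_card_slices S u (a := 0) (b := t) (by rw [map_zero, ht]; decide)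
    have e1 := charSum_self_eq_card_slices S u (a := 0) (b := t) (map_zero u) ht
    have e2 := bound u hu
    rw [hc] at e0
    rcases abs_cases (charSum S u) with ⟨e3, _⟩ | ⟨e3, _⟩ <;> rw [e3] at h8 e2
    · exact ⟨0, t, by rw [map_zero, ht]; decide, by omega, by omega⟩
    · exact ⟨t, 0, by rw [map_zero, ht]; decide, by omega, by omega⟩
  refine not_isSidon_slices (finrank_ker_dual hu hV) (isSidon_slice hS u a) (isSidon_slice hS u b) ha hb ?_ ?_
  · intro x hx y hy x' hx' y' hy' h
    have e : (x : V) + a + (y + a) = x' + b + (y' + b) := by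
      rw [add_add_add_comm, add_add_add_comm (x' : V), ← Submodule.coe_add, ← Submodule.coe_add, h,
        ZModModule.add_self, ZModModule.add_self]
    have key : ∀ p q : LinearMap.ker u, (p : V) + a ≠ q + b := fun p q e => by
      have := congrArg u e
      rw [map_add, map_add, LinearMap.mem_ker.1 p.2, LinearMap.mem_ker.1 q.2, zero_add,
        zero_add] at this
      exact hab this
    rcases hS _ (mem_slice.1 hx) _ (mem_slice.1 hy) _ (mem_slice.1 hx') _ (mem_slice.1 hy') e
      with h1 | h1 | h1
    · exact Subtype.ext (add_right_cancel h1)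
    · exact absurd h1 (key _ _)
    · exact absurd h1 (key _ _)
  · intro v hv
    -- The functional v on the hyperplane has two extensions, w and w + u. Their coefficients are,
    -- up to sign, F + G and F - G, and both are at most 8 in absolute value.
    obtain ⟨w, hw⟩ := LinearMap.exists_extend v
    have hw0 : w ≠ 0 := by rintro rfl; exact hv (by rw [← hw, LinearMap.zero_comp])
    have hw' : (w + u).comp (LinearMap.ker u).subtype = v := by
      rw [← hw]; ext x; simp
    have hw1 : w + u ≠ 0 := fun e => hv (by rw [← hw', e, LinearMap.zero_comp])
    have e1 := charSum_eq_slices S u w hab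
    have e2 := charSum_eq_slices S u (w + u) hab
    rw [hw] at e1
    rw [hw', LinearMap.add_apply, LinearMap.add_apply, signChar_add, signChar_add,
      signChar_eq_neg_of_ne hab] at e2
    have b1 := bound w hw0
    have b2 := bound _ hw1
    rw [e1] at b1
    rw [e2] at b2
    generalize charSum (slice S u a) v = F at *
    generalize charSum (slice S u b) v = G at *
    rcases signChar_eq_one_or (w a) with h1 | h1 <;> rcases signChar_eq_one_or (w b) with h2 | h2 <;>
      rcases signChar_eq_one_or (u b) with h3 | h3 <;> rw [h1, h2] at b1 <;>
      rw [h1, h2, h3] at b2 <;> rcases abs_le.1 b1 with ⟨b3, b4⟩ <;>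
      rcases abs_le.1 b2 with ⟨b5, b6⟩ <;> rcases abs_cases F with ⟨h4, _⟩ | ⟨h4, _⟩ <;>
      rcases abs_cases G with ⟨h5, _⟩ | ⟨h5, _⟩ <;> rw [h4, h5] <;> linarith

end SidonBounds

/-! ### Residual codes and the bound for length 36, dimension 19 -/

section Residual

theorem hammingNorm_add_le {ι : Type*} [Fintype ι] (x y : ι → ZMod 2) :
    hammingNorm (x + y) ≤ hammingNorm x + hammingNorm y := by
  have := hammingDist_triangle x 0 (-y)
  rw [hammingDist_zero_right, hammingDist_zero_left, hammingDist_eq_hammingNorm,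
    neg_add_eq_sub, ← neg_sub] at this
  simpa [ZModModule.neg_eq_self, ZModModule.sub_eq_add, add_comm] using this

theorem hammingNorm_eq_sum {ι : Type*} [Fintype ι] (x : ι → ZMod 2) :
    hammingNorm x = ∑ i, if x i ≠ 0 then 1 else 0 := by
  rw [hammingNorm, Finset.card_filter]

variable {ι : Type*}

/-- Restriction of vectors to the positions where `w` vanishes. -/
def residualMap (w : ι → ZMod 2) : (ι → ZMod 2) →ₗ[ZMod 2] ({i // w i = 0} → ZMod 2) :=
  LinearMap.funLeft (ZMod 2) (ZMod 2) Subtype.val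

/-- Where w is 1, exactly one of c and c + w is 1; where w is 0, they agree. -/
theorem hammingNorm_residual [Fintype ι] (w c : ι → ZMod 2) :
    hammingNorm c + hammingNorm (c + w) = 2 * hammingNorm (residualMap w c) + hammingNorm w := by
  have h : hammingNorm (residualMap w c) =
      ∑ i, if w i = 0 then (if c i ≠ 0 then 1 else 0) else 0 := by
    rw [← Finset.sum_filter, hammingNorm_eq_sum]
    exact (Finset.sum_subtype (Finset.univ.filter fun i => w i = 0) (by simp)
      (fun i => if c i ≠ 0 then 1 else 0)).symm
  rw [h, hammingNorm_eq_sum, hammingNorm_eq_sum, hammingNorm_eq_sum, Finset.mul_sum,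
    ← Finset.sum_add_distrib, ← Finset.sum_add_distrib]
  refine Finset.sum_congr rfl fun i _ => ?_
  rw [Pi.add_apply]
  generalize c i = a
  generalize w i = b
  revert a b
  decide

variable [DecidableEq ι]

/-- The zero vector together with the standard basis. -/
def zeroOrSingle : Option ι → ι → ZMod 2
  | none => 0
  | some i => Pi.single i 1

theorem zeroOrSingle_some_apply (i : ι) (b : Option ι) :
    zeroOrSingle b i = if b = some i then 1 else 0 := by
  cases b with
  | none => simp [zeroOrSingle]
  | some j =>
    by_cases h : i = j
    · subst h; simp [zeroOrSingle]
    · rw [if_neg (by simpa using Ne.symm h)]; exact Pi.single_eq_of_ne h 1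

theorem zeroOrSingle_injective : Function.Injective (zeroOrSingle (ι := ι)) := by
  intro a b h
  cases a with
  | none =>
    cases b with
    | none => rfl
    | some j =>
      have := congrFun h j
      simp [zeroOrSingle_some_apply] at this
  | some i =>
    have := congrFun h i
    rw [zeroOrSingle_some_apply, zeroOrSingle_some_apply, if_pos rfl] at this
    by_contra hne
    rw [if_neg (Ne.symm hne)] at this
    exact one_ne_zero this

theorem zeroOrSingle_sidon (a b c d : Option ι)
    (h : zeroOrSingle a + zeroOrSingle b = zeroOrSingle c + zeroOrSingle d) :
    a = b ∨ a = c ∨ a = d := by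
  by_contra! hne
  obtain ⟨h1, h2, h3⟩ := hne
  cases a with
  | some i =>
    have := congrFun h i
    simp only [Pi.add_apply, zeroOrSingle_some_apply, if_neg h1.symm, if_neg h2.symm,
      if_neg h3.symm, if_true, add_zero] at this
    exact one_ne_zero this
  | none =>
    obtain ⟨j, rfl⟩ := Option.ne_none_iff_exists'.1 h1.symm
    have e := congrFun h j
    simp only [Pi.add_apply, zeroOrSingle_some_apply, if_true] at e
    have h0 : (zeroOrSingle none : ι → ZMod 2) = 0 := rfl
    by_cases hc : c = some j
    · rw [hc, h0, zero_add, left_eq_add] at h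
      exact h3 (zeroOrSingle_injective (h0.trans h.symm))
    · by_cases hd : d = some j
      · rw [hd, h0, zero_add, right_eq_add] at h
        exact h2 (zeroOrSingle_injective (h0.trans h.symm))
      · rw [if_neg hc, if_neg hd] at e
        simp at e

variable [Fintype ι]

theorem hammingNorm_zeroOrSingle_le (a : Option ι) : hammingNorm (zeroOrSingle a) ≤ 1 := by
  cases a with
  | none => simp [zeroOrSingle]
  | some i =>
    refine Finset.card_le_one.2 fun j hj k hk => ?_
    have key : ∀ j, (zeroOrSingle (some i) : ι → ZMod 2) j ≠ 0 → j = i := fun j hj => by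
      by_contra h
      exact hj (Pi.single_eq_of_ne h 1)
    rw [key j (Finset.mem_filter.1 hj).2, key k (Finset.mem_filter.1 hk).2]

open Classical in
/-- A parity check matrix of a code of minimum distance at least `5`, together with the zero
column, is a Sidon set. -/
theorem exists_isSidon_of_five_le (R : Submodule (ZMod 2) (ι → ZMod 2))
    (hR : ∀ x ∈ R, x ≠ 0 → 5 ≤ hammingNorm x) :
    ∃ S : Finset ((ι → ZMod 2) ⧸ R), IsSidon S ∧ S.card = Fintype.card ι + 1 := by
  -- A sum of four vectors of weight at most 1 has weight at most 4, too small for a nonzero word of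
  -- R.
  have eq_zero : ∀ a b c d : Option ι, zeroOrSingle a + zeroOrSingle b + (zeroOrSingle c +
      zeroOrSingle d) ∈ R →
      zeroOrSingle a + zeroOrSingle b + (zeroOrSingle c + zeroOrSingle d) = 0 := by
    intro a b c d h
    by_contra hne
    have h1 := hR _ h hne
    have h2 := hammingNorm_add_le (zeroOrSingle a + zeroOrSingle b)
      (zeroOrSingle c + zeroOrSingle d)
    have h3 := hammingNorm_add_le (zeroOrSingle a) (zeroOrSingle b)
    have h4 := hammingNorm_add_le (zeroOrSingle c) (zeroOrSingle d)
    have h5 := hammingNorm_zeroOrSingle_le a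
    have h6 := hammingNorm_zeroOrSingle_le b
    have h7 := hammingNorm_zeroOrSingle_le c
    have h8 := hammingNorm_zeroOrSingle_le d
    omega
  have eq_of : ∀ a b c d : Option ι, R.mkQ (zeroOrSingle a) + R.mkQ (zeroOrSingle b)
      = R.mkQ (zeroOrSingle c) + R.mkQ (zeroOrSingle d) →
      zeroOrSingle a + zeroOrSingle b = zeroOrSingle c + zeroOrSingle d := by
    intro a b c d h
    rw [← map_add, ← map_add, ← sub_eq_zero, ← map_sub, ZModModule.sub_eq_add,
      Submodule.mkQ_apply, Submodule.Quotient.mk_eq_zero] at h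
    exact (add_eq_zero_iff_eq_of_two _ _).1 (eq_zero a b c d h)
  have inj : Function.Injective (fun a : Option ι => R.mkQ (zeroOrSingle a)) := by
    intro a b h
    exact zeroOrSingle_injective (add_right_cancel (eq_of a none b none (by
      dsimp only at h; rw [h])))
  refine ⟨Finset.univ.image (fun a : Option ι => R.mkQ (zeroOrSingle a)), ?_, ?_⟩
  · intro a ha b hb c hc d hd h
    obtain ⟨a, _, rfl⟩ := Finset.mem_image.1 ha
    obtain ⟨b, _, rfl⟩ := Finset.mem_image.1 hb
    obtain ⟨c, _, rfl⟩ := Finset.mem_image.1 hc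
    obtain ⟨d, _, rfl⟩ := Finset.mem_image.1 hd
    rcases zeroOrSingle_sidon a b c d (eq_of a b c d h) with rfl | rfl | rfl <;> simp
  · rw [Finset.card_image_of_injective _ inj, Finset.card_univ, Fintype.card_option]

theorem exists_hammingNorm_le_eight (C : Submodule (ZMod 2) (Fin 36 → ZMod 2))
    (hC : Module.finrank (ZMod 2) C = 19) : ∃ x ∈ C, x ≠ 0 ∧ hammingNorm x ≤ 8 := by
  by_contra! hmin
  obtain ⟨w, ⟨hwC, hw0⟩, hw⟩ : ∃ w, (w ∈ C ∧ w ≠ 0) ∧ ∀ c, c ∈ C ∧ c ≠ 0 →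
      hammingNorm w ≤ hammingNorm c := by
    have hne : {c | c ∈ C ∧ c ≠ 0}.Nonempty := by
      obtain ⟨c, hc, hc0⟩ := C.exists_mem_ne_zero_of_ne_bot (by
        rintro rfl
        rw [finrank_bot] at hC
        omega)
      exact ⟨c, hc, hc0⟩
    obtain ⟨w, h1, h2⟩ := Set.exists_min_image _ hammingNorm (Set.toFinite _) hne
    exact ⟨w, h1, h2⟩
  have hw9 := hmin w hwC hw0
  have res_ge : ∀ c ∈ C, c ≠ 0 → c ≠ w → 5 ≤ hammingNorm (residualMap w c) := by
    intro c hc h0 hcw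
    have h1 := hammingNorm_residual w c
    have h2 := hw c ⟨hc, h0⟩
    have h3 := hw (c + w) ⟨C.add_mem hc hwC, fun e => hcw ((add_eq_zero_iff_eq_of_two _ _).1 e)⟩
    omega
  have res_w : residualMap w w = 0 := funext fun i => i.2
  have hR : ∀ x ∈ C.map (residualMap w), x ≠ 0 → 5 ≤ hammingNorm x := by
    rintro _ ⟨c, hc, rfl⟩ h0
    refine res_ge c hc ?_ ?_
    · rintro rfl; exact h0 (map_zero _)
    · rintro rfl; exact h0 res_w
  have hrank : Module.finrank (ZMod 2) (C.map (residualMap w)) = 18 := by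
    have h1 := LinearMap.finrank_range_add_finrank_ker ((residualMap w).domRestrict C)
    -- Any word of C other than 0 and w has residual weight at least 5, so only multiples of w are
    -- killed and the dimension drops by one.
    have h2 : LinearMap.ker ((residualMap w).domRestrict C) =
        Submodule.span (ZMod 2) {⟨w, hwC⟩} := by
      apply le_antisymm
      · rintro ⟨c, hc⟩ h
        have h' : residualMap w c = 0 := h
        by_cases h0 : c = 0
        · subst h0; exact Submodule.zero_mem _
        · by_cases hcw : c = w
          · subst hcw; exact Submodule.mem_span_singleton_self _
          · have := res_ge c hc h0 hcw
            rw [h', hammingNorm_zero] at this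
            omega
      · rw [Submodule.span_singleton_le_iff_mem]; exact res_w
    rw [h2, finrank_span_singleton (by simpa [Subtype.ext_iff] using hw0), hC,
      LinearMap.range_domRestrict] at h1
    omega
  have hcard : Fintype.card {i // w i = 0} + hammingNorm w = 36 := by
    rw [Fintype.card_subtype, hammingNorm, Finset.card_filter_add_card_filter_not]
    simp
  obtain ⟨S, hS, hSc⟩ := exists_isSidon_of_five_le _ hR
  have hQ := Submodule.finrank_quotient_add_finrank (C.map (residualMap w))
  rw [hrank, Module.finrank_fintype_fun_eq_card] at hQ
  have : Finite (({i // w i = 0} → ZMod 2) ⧸ C.map (residualMap w)) := Quotient.finite _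
  by_cases h9 : hammingNorm w = 9
  · exact IsSidon.card_ne_twentyEight (by omega) hS (by omega)
  -- If wt(w) ≥ 10, the quotient has dimension 18 - wt(w) ≤ 8 and embeds in dimension 8. As wt(w) ≤
  -- 18, the Sidon set has at least 19 points.
  · obtain ⟨f, hf⟩ := (finrank_le_iff_exists_linearMap (R := ZMod 2)
      (M := ({i // w i = 0} → ZMod 2) ⧸ C.map (residualMap w)) (M' := Fin 8 → ZMod 2)).1 (by
        rw [Module.finrank_fintype_fun_eq_card, Fintype.card_fin]; omega)
    have h18 := IsSidon.card_le_eighteen (V := Fin 8 → ZMod 2) (by simp)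
      (hS.image_of_injective f.toAddMonoidHom hf)
    rw [Finset.card_image_of_injective S (f := f.toAddMonoidHom) hf] at h18
    omega

theorem not_isLinearCode_of_eight_lt {d : ℕ} (hd : 8 < d) (D : Set (Fin 36 → ZMod 2)) :
    ¬ IsLinearCode 36 19 d D := by
  rintro ⟨⟨V, rfl, hV⟩, _, hmin⟩
  obtain ⟨x, hx, hx0, h8⟩ := exists_hammingNorm_le_eight V hV
  have := hmin ⟨x, hx, 0, V.zero_mem, hx0, (hammingDist_zero_right x).symm⟩
  omega

end Residual

/-! ### Symbol weights in the additive code -/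

section AdditiveCode

/-- The vector over the Klein four-group whose coordinate `i` consists of the bits `i` and
`i + 9` of `n`. -/
def bitVec (n : ℕ) : Fin 9 → ZMod 2 × ZMod 2 := fun i =>
  (if n.testBit i then 1 else 0, if n.testBit (i + 9) then 1 else 0)

theorem bitVec_xor (a b : ℕ) : bitVec (a ^^^ b) = bitVec a + bitVec b := by
  have key : ∀ p q : Bool, (if (p ^^ q) = true then (1 : ZMod 2) else 0)
      = (if p = true then 1 else 0) + (if q = true then 1 else 0) := by decide
  funext i
  simp only [bitVec, Nat.testBit_xor, key, Pi.add_apply, Prod.mk_add_mk]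

theorem bitVec_zero : bitVec 0 = 0 := by
  funext i
  simp [bitVec]

/-- The sum of the values of `f` at all partial sums (with respect to `xor`) of a list,
shifted by `a`. -/
def xorSum (f : ℕ → ℕ) : List ℕ → ℕ → ℕ
  | [], a => f a
  | m :: ms, a => xorSum f ms a + xorSum f ms (a ^^^ m)

/-- This turns weight counts over all coefficient vectors into a recursion on natural numbers, which
kernel computation handles for the 1024 words. -/
theorem sum_linearCombination_bitVec (f : (Fin 9 → ZMod 2 × ZMod 2) → ℕ) :
    ∀ (n : ℕ) (m : Fin n → ℕ) (a : ℕ),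
      ∑ x : Fin n → ZMod 2, f (bitVec a + ∑ k, x k • bitVec (m k))
        = xorSum (fun k => f (bitVec k)) (List.ofFn m) a := by
  intro n
  induction n with
  | zero => intro m a; simp [xorSum]
  | succ n ih =>
    intro m a
    rw [List.ofFn_succ, xorSum, ← ih, ← ih,
      ← Equiv.sum_comp (Fin.consEquiv (fun _ : Fin (n + 1) => ZMod 2)), Fintype.sum_prod_type]
    have h2 : ∀ g : ZMod 2 → ℕ, ∑ t, g t = g 0 + g 1 := fun g => Fin.sum_univ_two g
    rw [h2]
    congr 1 <;> refine Finset.sum_congr rfl fun x _ => ?_ <;> rw [Fin.sum_univ_succ] <;>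
      simp [Fin.consEquiv, bitVec_xor, add_assoc]

/-- The rows of the generator matrix in the basis `1, ω`, in binary notation. -/
def rowBits : Fin 10 → ℕ := ![16865, 229920, 98466, 50368, 196932, 100736, 49512, 135264, 33200, 254016]

/-- The codeword with given coefficients with respect to the rows of the generator matrix, in the
basis `1, ω`. -/
def word : (Fin 10 → ZMod 2) →ₗ[ZMod 2] (Fin 9 → ZMod 2 × ZMod 2) :=
  Fintype.linearCombination (ZMod 2) (fun k => bitVec (rowBits k))

/-- The number of nonzero coordinates. -/
def symbolWeight (c : Fin 9 → ZMod 2 × ZMod 2) : ℕ := ∑ i, if c i = 0 then 0 else 1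

/-- The number of nonzero coordinates of `bitVec n`. -/
def bitWeight (n : ℕ) : ℕ :=
  ∑ i : Fin 9, if (n.testBit i || n.testBit (i + 9)) = true then 1 else 0

theorem symbolWeight_bitVec (n : ℕ) : symbolWeight (bitVec n) = bitWeight n := by
  have key : ∀ p q : Bool, (if ((if p = true then 1 else 0, if q = true then 1 else 0) :
      ZMod 2 × ZMod 2) = 0 then 0 else 1) = if (p || q) = true then 1 else 0 := by decide
  exact Finset.sum_congr rfl fun i _ => key _ _

theorem sum_word (f : ℕ → ℕ) :
    ∑ x, f (symbolWeight (word x)) = xorSum (fun k => f (bitWeight k)) (List.ofFn rowBits) 0 := by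
  have := sum_linearCombination_bitVec (fun c => f (symbolWeight c)) 10 rowBits 0
  simpa only [bitVec_zero, zero_add, symbolWeight_bitVec, word,
    Fintype.linearCombination_apply] using this

theorem card_symbolWeight_lt_four :
    (Finset.univ.filter fun x => symbolWeight (word x) < 4).card = 1 := by
  rw [Finset.card_filter, sum_word (fun k => if k < 4 then 1 else 0)]
  decide +kernel

theorem card_even_symbolWeight :
    (Finset.univ.filter fun x => (symbolWeight (word x) : ZMod 2) = 0).card = 496 := by
  rw [Finset.card_filter, sum_word (fun k => if (k : ZMod 2) = 0 then 1 else 0)]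
  decide +kernel

theorem card_odd_symbolWeight :
    (Finset.univ.filter fun x => (symbolWeight (word x) : ZMod 2) = 1).card = 528 := by
  rw [Finset.card_filter, sum_word (fun k => if (k : ZMod 2) = 1 then 1 else 0)]
  decide +kernel

theorem symbolWeight_zero : symbolWeight 0 = 0 := by simp [symbolWeight]

theorem four_le_symbolWeight {x : Fin 10 → ZMod 2} (hx : x ≠ 0) : 4 ≤ symbolWeight (word x) := by
  by_contra! h
  refine hx (Finset.card_le_one.1 card_symbolWeight_lt_four.le x ?_ 0 ?_)
  · simpa using h
  · simp [symbolWeight_zero]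

theorem word_injective : Function.Injective word := by
  rw [injective_iff_map_eq_zero]
  intro x hx
  by_contra h
  have := four_le_symbolWeight h
  rw [hx, symbolWeight_zero] at this
  omega

end AdditiveCode

/-! ### Parameters and weight 9 words of the binary codes -/

section BinaryCode

/-- The block of length `4` obtained from the symbol `p`, the vector `1111` if `y = 1` and the
vector `1000` if `ε = 1`. -/
def block (p : ZMod 2 × ZMod 2) (y ε : ZMod 2) : Fin 4 → ZMod 2 :=
  ![y + ε, p.2 + y, p.1 + y, p.1 + p.2 + y]

theorem block_add (p p' : ZMod 2 × ZMod 2) (y y' ε ε' : ZMod 2) :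
    block (p + p') (y + y') (ε + ε') = block p y ε + block p' y' ε' := by
  funext i
  fin_cases i <;> simp [block] <;> ring

theorem block_smul (a : ZMod 2) (p : ZMod 2 × ZMod 2) (y ε : ZMod 2) :
    block (a • p) (a * y) (a * ε) = a • block p y ε := by
  funext i
  fin_cases i <;> simp [block] <;> ring

theorem block_eq_zero : ∀ (p : ZMod 2 × ZMod 2) (y ε : ZMod 2), block p y ε = 0 →
    p = 0 ∧ y = 0 ∧ ε = 0 := by
  unfold block; decide

theorem ofBlocks_finProdFinEquiv {m : ℕ} (b : Fin m → Fin 4 → ZMod 2) (p : Fin m × Fin 4) :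
    ofBlocks b (finProdFinEquiv p) = b p.1 p.2 := by
  have h : ∀ j, ofBlocks b j = b (finProdFinEquiv.symm j).1 (finProdFinEquiv.symm j).2 :=
    fun j => rfl
  rw [h, Equiv.symm_apply_apply]

theorem ofBlocks_injective {m : ℕ} : Function.Injective (ofBlocks (m := m)) := by
  intro b b' h
  funext i k
  rw [← ofBlocks_finProdFinEquiv b (i, k), h, ofBlocks_finProdFinEquiv]

theorem hammingNorm_ofBlocks {m : ℕ} (b : Fin m → Fin 4 → ZMod 2) :
    hammingNorm (ofBlocks b) = ∑ i, hammingNorm (b i) := by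
  rw [hammingNorm_eq_sum, ← Equiv.sum_comp finProdFinEquiv, Fintype.sum_prod_type]
  refine Finset.sum_congr rfl fun i _ => ?_
  rw [hammingNorm_eq_sum]
  simp only [ofBlocks_finProdFinEquiv]

/-- The coefficients of a codeword: those of the additive code, those of the all-one blocks, and
that of the vector `1000 ⋯ 1000`. -/
abbrev Coeffs : Type := (Fin 10 → ZMod 2) × (Fin 9 → ZMod 2) × ZMod 2

/-- The binary vector with given coefficients. -/
def encode : Coeffs →ₗ[ZMod 2] (Fin 36 → ZMod 2) where
  toFun t := ofBlocks (m := 9) fun i => block (word t.1 i) (t.2.1 i) t.2.2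
  map_add' s t := by
    simp only [Prod.fst_add, Prod.snd_add, map_add, Pi.add_apply, block_add]; rfl
  map_smul' a t := by
    simp only [Prod.smul_fst, Prod.smul_snd, map_smul, Pi.smul_apply, smul_eq_mul, block_smul]; rfl

theorem encode_apply (x : Fin 10 → ZMod 2) (y : Fin 9 → ZMod 2) (ε : ZMod 2) :
    encode (x, y, ε) = ofBlocks (m := 9) fun i => block (word x i) (y i) ε := rfl

theorem encode_injective : Function.Injective encode := by
  rw [injective_iff_map_eq_zero]
  rintro ⟨x, y, ε⟩ h
  have h1 : (fun i => block (word x i) (y i) ε) = 0 := ofBlocks_injective (m := 9) h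
  have h2 := fun i => block_eq_zero _ _ _ (congrFun h1 i)
  have hx : word x = 0 := funext fun i => (h2 i).1
  have hy : y = 0 := funext fun i => (h2 i).2.1
  rw [word_injective (hx.trans (map_zero word).symm), hy, (h2 0).2.2]
  rfl

theorem hammingNorm_encode (x : Fin 10 → ZMod 2) (y : Fin 9 → ZMod 2) (ε : ZMod 2) :
    hammingNorm (encode (x, y, ε)) = ∑ i, hammingNorm (block (word x i) (y i) ε) :=
  hammingNorm_ofBlocks (m := 9) fun i => block (word x i) (y i) ε

/-- The functional whose vanishing fixes the parity of the number of all-one blocks. -/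
def parityFunctional (κ : ZMod 2) : Module.Dual (ZMod 2) Coeffs where
  toFun t := ∑ i, t.2.1 i - κ * t.2.2
  map_add' s t := by
    simp only [Prod.snd_add, Prod.fst_add, Pi.add_apply, Finset.sum_add_distrib]; ring
  map_smul' a t := by
    simp only [Prod.smul_snd, Prod.smul_fst, Pi.smul_apply, smul_eq_mul, ← Finset.mul_sum,
      RingHom.id_apply]
    ring

theorem mem_ker_parityFunctional {κ : ZMod 2} {x : Fin 10 → ZMod 2} {y : Fin 9 → ZMod 2}
    {ε : ZMod 2} : (x, y, ε) ∈ LinearMap.ker (parityFunctional κ) ↔ ∑ i, y i = κ * ε := by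
  rw [LinearMap.mem_ker, ← sub_eq_zero (b := κ * ε)]; rfl

/-- The binary code obtained from the additive code; `κ = 0` is Construction O and `κ = 1` is
Construction E. -/
def binaryCode (κ : ZMod 2) : Submodule (ZMod 2) (Fin 36 → ZMod 2) :=
  (LinearMap.ker (parityFunctional κ)).map encode

theorem encode_mem_binaryCode {κ : ZMod 2} {x : Fin 10 → ZMod 2} {y : Fin 9 → ZMod 2}
    {ε : ZMod 2} (h : ∑ i, y i = κ * ε) : encode (x, y, ε) ∈ binaryCode κ :=
  Submodule.mem_map_of_mem (mem_ker_parityFunctional.2 h)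

theorem finrank_binaryCode (κ : ZMod 2) : Module.finrank (ZMod 2) (binaryCode κ) = 19 := by
  rw [binaryCode, ← (Submodule.equivMapOfInjective encode encode_injective _).finrank_eq]
  -- The coefficient space has dimension 10 + 9 + 1 = 20, and a nonzero functional cuts it to 19.
  have h0 : parityFunctional κ ≠ 0 := fun h => by
    have := congrArg (fun f => f ((0, Pi.single 0 1, 0) : Coeffs)) h
    simp [parityFunctional] at this
  have := Module.Dual.finrank_ker_add_one_of_ne_zero h0
  simp only [Module.finrank_prod, Module.finrank_fintype_fun_eq_card, Fintype.card_fin,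
    Module.finrank_self] at this
  omega

theorem hammingNorm_block_zero : ∀ (p : ZMod 2 × ZMod 2) (y : ZMod 2),
    hammingNorm (block p y 0) = if p = 0 then (if y = 0 then 0 else 4) else 2 := by
  unfold block; decide

theorem one_le_hammingNorm_block_one : ∀ (p : ZMod 2 × ZMod 2) (y : ZMod 2),
    1 ≤ hammingNorm (block p y 1) := by
  unfold block; decide

theorem hammingNorm_block_one_eq_one_iff : ∀ (p : ZMod 2 × ZMod 2) (y : ZMod 2),
    hammingNorm (block p y 1) = 1 ↔ y = if p = 0 then 0 else 1 := by
  unfold block; decide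

theorem zmod_two_eq_zero_or_one (a : ZMod 2) : a = 0 ∨ a = 1 := by
  revert a; decide

/-- For ε = 0 and x = 0 the word consists of a positive even number of all-one blocks. For ε = 0 and
x ≠ 0 at least four blocks have weight 2. For ε = 1 all nine blocks are nonzero. -/
theorem eight_le_hammingNorm {κ : ZMod 2} {c : Fin 36 → ZMod 2} (hc : c ∈ binaryCode κ)
    (h0 : c ≠ 0) : 8 ≤ hammingNorm c := by
  obtain ⟨⟨x, y, ε⟩, ht, rfl⟩ := hc
  have hpar := mem_ker_parityFunctional.1 ht
  rw [hammingNorm_encode]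
  rcases zmod_two_eq_zero_or_one ε with rfl | rfl
  · by_cases hx : x = 0
    · subst hx
      have e : ∀ i, hammingNorm (block (word 0 i) (y i) 0) = 4 * if y i ≠ 0 then 1 else 0 := by
        intro i
        rw [hammingNorm_block_zero, map_zero, Pi.zero_apply, if_pos rfl]
        by_cases h : y i = 0 <;> simp [h]
      simp only [e]
      rw [← Finset.mul_sum, ← hammingNorm_eq_sum]
      have hy : y ≠ 0 := by rintro rfl; exact h0 (map_zero encode)
      have h1 := hammingNorm_pos_iff.2 hy
      have h2 : ((hammingNorm y : ℕ) : ZMod 2) = 0 := by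
        rw [mul_zero] at hpar
        rw [← hpar, hammingNorm_eq_sum, Nat.cast_sum]
        refine Finset.sum_congr rfl fun i _ => ?_
        rcases zmod_two_eq_zero_or_one (y i) with h | h <;> rw [h] <;> simp
      rw [ZMod.natCast_eq_zero_iff] at h2
      omega
    · have h1 := four_le_symbolWeight hx
      have h2 : 2 * symbolWeight (word x) ≤ ∑ i, hammingNorm (block (word x i) (y i) 0) := by
        rw [symbolWeight, Finset.mul_sum]
        refine Finset.sum_le_sum fun i _ => ?_
        rw [hammingNorm_block_zero]
        split_ifs <;> simp
      omega
  · have := Finset.card_nsmul_le_sum Finset.univ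
      (fun i => hammingNorm (block (word x i) (y i) 1)) 1
      (fun i _ => one_le_hammingNorm_block_one _ _)
    simp only [Finset.card_univ, Fintype.card_fin, smul_eq_mul] at this
    omega

theorem exists_hammingNorm_eq_eight (κ : ZMod 2) :
    ∃ c ∈ binaryCode κ, hammingNorm c = 8 := by
  refine ⟨encode (0, Pi.single 0 1 + Pi.single 1 1, 0), encode_mem_binaryCode ?_, ?_⟩
  · rw [mul_zero]; decide
  · rw [hammingNorm_encode, map_zero]
    simp only [hammingNorm_block_zero]
    decide

theorem isLinearCode_binaryCode (κ : ZMod 2) : IsLinearCode 36 19 8 (binaryCode κ) := by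
  refine ⟨⟨binaryCode κ, rfl, finrank_binaryCode κ⟩, ?_, ?_⟩
  · obtain ⟨c, hc, h8⟩ := exists_hammingNorm_eq_eight κ
    refine ⟨c, hc, 0, (binaryCode κ).zero_mem, ?_, by rw [hammingDist_zero_right, h8]⟩
    rintro rfl
    simp at h8
  · rintro _ ⟨x, hx, y, hy, hne, rfl⟩
    rw [hammingDist_eq_hammingNorm, ZModModule.neg_eq_self]
    exact eight_le_hammingNorm ((binaryCode κ).add_mem hx hy)
      (fun e => hne ((add_eq_zero_iff_eq_of_two _ _).1 e))

theorem isOptimalLinearCode_binaryCode (κ : ZMod 2) :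
    IsOptimalLinearCode 36 19 8 (binaryCode κ : Set (Fin 36 → ZMod 2)) :=
  ⟨isLinearCode_binaryCode κ, fun _ hd D => not_isLinearCode_of_eight_lt hd D⟩

/-- The choice of all-one blocks giving the word of weight `9` over a codeword of the additive
code. -/
def minimalBlocks (x : Fin 10 → ZMod 2) : Fin 9 → ZMod 2 := fun i => if word x i = 0 then 0 else 1

theorem sum_minimalBlocks (x : Fin 10 → ZMod 2) :
    ∑ i, minimalBlocks x i = (symbolWeight (word x) : ZMod 2) := by
  rw [symbolWeight, Nat.cast_sum]
  exact Finset.sum_congr rfl fun i _ => by unfold minimalBlocks; split_ifs <;> simp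

/-- Weight 9 is odd, so ε = 1 and each of the nine blocks has weight 1. This determines y from x,
and the parity condition on y becomes one on the symbol weight. -/
theorem weightDistribution_binaryCode_nine (κ : ZMod 2) :
    weightDistribution (binaryCode κ : Set (Fin 36 → ZMod 2)) 9
      = (Finset.univ.filter fun x => (symbolWeight (word x) : ZMod 2) = κ).card := by
  have hset : {c ∈ (binaryCode κ : Set (Fin 36 → ZMod 2)) | hammingNorm c = 9}
      = (fun x => encode (x, minimalBlocks x, 1)) ''
        (Finset.univ.filter fun x => (symbolWeight (word x) : ZMod 2) = κ :
          Finset (Fin 10 → ZMod 2)) := by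
    ext c
    simp only [Set.mem_ofPred_eq, Set.mem_image, Finset.coe_filter, Finset.mem_univ, true_and]
    constructor
    · rintro ⟨⟨⟨x, y, ε⟩, ht, rfl⟩, h9⟩
      have hpar := mem_ker_parityFunctional.1 ht
      rw [hammingNorm_encode] at h9
      rcases zmod_two_eq_zero_or_one ε with rfl | rfl
      · exfalso
        have : 2 ∣ ∑ i, hammingNorm (block (word x i) (y i) 0) := by
          refine Finset.dvd_sum fun i _ => ?_
          rw [hammingNorm_block_zero]
          split_ifs <;> decide
        omega
      · have h1 : ∀ i ∈ Finset.univ, 1 = hammingNorm (block (word x i) (y i) 1) :=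
          (Finset.sum_eq_sum_iff_of_le (fun i _ => one_le_hammingNorm_block_one _ _)).1
            (by rw [h9]; simp)
        have hy : y = minimalBlocks x := funext fun i =>
          (hammingNorm_block_one_eq_one_iff _ _).1 (h1 i (Finset.mem_univ i)).symm
        subst hy
        refine ⟨x, ?_, rfl⟩
        rw [← sum_minimalBlocks, hpar, mul_one]
    · rintro ⟨x, hx, rfl⟩
      refine ⟨encode_mem_binaryCode (by rw [sum_minimalBlocks, hx, mul_one]), ?_⟩
      rw [hammingNorm_encode]
      have h1 : ∀ i, hammingNorm (block (word x i) (minimalBlocks x i) 1) = 1 := fun i =>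
        (hammingNorm_block_one_eq_one_iff _ _).2 rfl
      simp [h1]
  rw [weightDistribution, hset, Set.ncard_image_of_injective, Set.ncard_coe_finset]
  intro x x' h
  exact congrArg Prod.fst (encode_injective h)

theorem weightDistribution_binaryCode_ne :
    weightDistribution (binaryCode 0 : Set (Fin 36 → ZMod 2))
      ≠ weightDistribution (binaryCode 1 : Set (Fin 36 → ZMod 2)) := by
  intro h
  have h9 := congrFun h 9
  rw [weightDistribution_binaryCode_nine, weightDistribution_binaryCode_nine,
    card_even_symbolWeight, card_odd_symbolWeight] at h9
  omega

theorem CodeEquivalent.weightDistribution_eq {n : ℕ} {C D : Set (Fin n → ZMod 2)}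
    (h : CodeEquivalent C D) : weightDistribution C = weightDistribution D := by
  obtain ⟨σ, rfl⟩ := h
  funext w
  have norm_comp : ∀ c : Fin n → ZMod 2, hammingNorm (c ∘ σ) = hammingNorm c := fun c => by
    rw [hammingNorm_eq_sum, hammingNorm_eq_sum]
    exact Equiv.sum_comp σ (fun i => if c i ≠ 0 then 1 else 0)
  have hset : {c ∈ (fun c : Fin n → ZMod 2 => c ∘ σ) '' C | hammingNorm c = w}
      = (fun c : Fin n → ZMod 2 => c ∘ σ) '' {c ∈ C | hammingNorm c = w} := by
    ext c
    simp only [Set.mem_ofPred_eq, Set.mem_image]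
    constructor
    · rintro ⟨⟨c, hc, rfl⟩, hw⟩
      exact ⟨c, ⟨hc, by rwa [norm_comp] at hw⟩, rfl⟩
    · rintro ⟨c, ⟨hc, hw⟩, rfl⟩
      exact ⟨⟨c, hc, rfl⟩, by rwa [norm_comp]⟩
  rw [weightDistribution, weightDistribution, hset,
    Set.ncard_image_of_injective _ σ.surjective.injective_comp_right]

end BinaryCode

/-! ### The codes d and d' in coefficient form -/

section Constructions

theorem columnVec_eq_encode (i : Fin 9) : columnVec i = encode (0, Pi.single i 1, 0) := by
  rw [encode_apply]
  refine congrArg (ofBlocks (m := 9)) (funext fun j => ?_)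
  by_cases h : j = i
  · subst h; simp [block]
  · simp [block, h]

theorem evenSums_nine :
    evenSums 9 = {v | ∃ y : Fin 9 → ZMod 2, ∑ i, y i = 0 ∧ v = encode (0, y, 0)} := by
  have sum_col : ∀ S : Finset (Fin 9), ∑ i ∈ S, columnVec i
      = encode (0, ∑ i ∈ S, Pi.single i 1, 0) := fun S => by
    have e : ((0, ∑ i ∈ S, Pi.single i 1, 0) : Coeffs) = ∑ i ∈ S, (0, Pi.single i 1, 0) := by
      rw [Prod.ext_iff, Prod.ext_iff]
      simp [Prod.fst_sum, Prod.snd_sum]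
    rw [e, map_sum]
    exact Finset.sum_congr rfl fun i _ => columnVec_eq_encode i
  have card_cast : ∀ S : Finset (Fin 9),
      ∑ j, (∑ i ∈ S, Pi.single i 1 : Fin 9 → ZMod 2) j = (S.card : ZMod 2) := fun S => by
    simp only [Finset.sum_apply]
    rw [Finset.sum_comm]
    simp
  ext v
  constructor
  · rintro ⟨S, hS, rfl⟩
    exact ⟨_, by rw [card_cast, ZMod.natCast_eq_zero_iff_even.2 hS], sum_col S⟩
  · rintro ⟨y, hy, rfl⟩
    have e : y = ∑ i ∈ Finset.univ.filter (fun i => y i ≠ 0), Pi.single i 1 := by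
      funext j
      rw [Finset.sum_apply, Finset.sum_filter]
      rcases zmod_two_eq_zero_or_one (y j) with h | h
      · rw [h, Finset.sum_eq_zero]
        intro i _
        by_cases hij : j = i
        · subst hij; simp [h]
        · simp [Pi.single_eq_of_ne hij]
      · rw [h, Finset.sum_eq_single j]
        · simp [h]
        · intro i _ hij
          simp [Pi.single_eq_of_ne hij.symm]
        · simp
    refine ⟨Finset.univ.filter fun i => y i ≠ 0, ?_, ?_⟩
    · rw [← ZMod.natCast_eq_zero_iff_even, ← card_cast, ← e, hy]
    · rw [sum_col, ← e]

/-- The zero term `Pi.single 8 0` gives both generators the common shape `Pi.single 8 κ`: since 0111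
= 1000 + 1111, the vector d₂ has an all-one block added in the last position. -/
theorem dOne_eq_encode : dOne 9 = encode (0, Pi.single 8 0, 1) := by
  rw [encode_apply]
  refine congrArg (ofBlocks (m := 9)) (funext fun j => ?_)
  simp [block]

theorem dTwo_eq_encode : dTwo 9 = encode (0, Pi.single 8 1, 1) := by
  rw [encode_apply]
  refine congrArg (ofBlocks (m := 9)) (funext fun j => ?_)
  fin_cases j <;> rw [map_zero] <;> decide

theorem mem_span_evenSums_iff (κ : ZMod 2) (v : Fin (9 * 4) → ZMod 2) :
    v ∈ Submodule.span (ZMod 2) (evenSums 9 ∪ {encode (0, Pi.single 8 κ, 1)}) ↔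
      ∃ (y : Fin 9 → ZMod 2) (ε : ZMod 2), ∑ i, y i = κ * ε ∧ v = encode (0, y, ε) := by
  constructor
  · intro hv
    induction hv using Submodule.span_induction with
    | mem v hv =>
      rw [evenSums_nine] at hv
      rcases hv with ⟨y, hy, rfl⟩ | rfl
      · exact ⟨y, 0, by rw [hy, mul_zero], rfl⟩
      · exact ⟨_, 1, by simp, rfl⟩
    | zero => exact ⟨0, 0, by simp, (map_zero encode).symm⟩
    | add v w _ _ hv hw =>
      obtain ⟨y, ε, h, rfl⟩ := hv
      obtain ⟨y', ε', h', rfl⟩ := hw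
      refine ⟨y + y', ε + ε', ?_, ?_⟩
      · simp only [Pi.add_apply, Finset.sum_add_distrib, h, h', mul_add]
      · rw [← map_add]; simp
    | smul a v _ hv =>
      obtain ⟨y, ε, h, rfl⟩ := hv
      refine ⟨a • y, a • ε, ?_, ?_⟩
      · simp only [Pi.smul_apply, smul_eq_mul, ← Finset.mul_sum, h]; ring
      · rw [← map_smul]; simp
  · rintro ⟨y, ε, h, rfl⟩
    -- Subtracting ε copies of the extra generator removes κε from the last entry of y, which leaves
    -- a vector of even parity.
    have e : encode (0, y, ε)
        = encode (0, y - Pi.single 8 (κ * ε), 0) + ε • encode (0, Pi.single 8 κ, 1) := by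
      rw [← map_smul, ← map_add]
      congr 1
      simp [← Pi.single_smul, mul_comm]
    rw [e]
    refine Submodule.add_mem _ (Submodule.subset_span (Or.inl ?_))
      (Submodule.smul_mem _ _ (Submodule.subset_span (Or.inr rfl)))
    rw [evenSums_nine]
    exact ⟨_, by simp [Finset.sum_sub_distrib, h], rfl⟩

end Constructions

/-! ### Transfer from GF(4) to pairs of bits -/

section Field

variable {F : Type*} [Field F]

theorem two_eq_zero_of_card_four (hF : Nat.card F = 4) : (2 : F) = 0 := by
  have : Finite F := Nat.finite_of_card_ne_zero (by omega)
  have h : (4 : F) = 0 := by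
    have := card_nsmul_eq_zero' (G := F) (x := 1)
    rw [hF] at this
    simpa using this
  have h' : (2 : F) * 2 = 0 := by rw [← h]; norm_num
  exact mul_self_eq_zero.1 h'

/-- The additive isomorphism from the Klein four-group to `GF(4)` given by the basis `1, ω`. -/
def toField (h2 : (2 : F) = 0) (ω : F) : ZMod 2 × ZMod 2 →+ F where
  toFun p := (if p.1 = 0 then 0 else 1) + (if p.2 = 0 then 0 else ω)
  map_zero' := by simp
  map_add' := by
    have key : ∀ (c : F) (a b : ZMod 2), (if a + b = 0 then 0 else c)
        = (if a = 0 then 0 else c) + (if b = 0 then 0 else c) := by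
      intro c a b
      have hc : 0 = c + c := by rw [← two_mul, h2, zero_mul]
      rcases zmod_two_eq_zero_or_one a with rfl | rfl <;>
        rcases zmod_two_eq_zero_or_one b with rfl | rfl
      · simp
      · simp
      · simp
      · rw [if_pos (by decide)]; simpa using hc
    intro p q
    rw [Prod.fst_add, Prod.snd_add, key, key, add_add_add_comm]

theorem toField_apply (h2 : (2 : F) = 0) (ω : F) (p : ZMod 2 × ZMod 2) :
    toField h2 ω p = (if p.1 = 0 then 0 else 1) + (if p.2 = 0 then 0 else ω) := rfl

theorem omega_ne {ω : F} (h2 : (2 : F) = 0) (hω : ω ^ 2 + ω + 1 = 0) : ω ≠ 0 ∧ ω ≠ 1 := by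
  constructor
  · rintro rfl; simp at hω
  · rintro rfl
    rw [one_pow, one_add_one_eq_two, h2, zero_add] at hω
    exact one_ne_zero hω

theorem phi_toField {ω : F} (h2 : (2 : F) = 0) (hω : ω ^ 2 + ω + 1 = 0) (p : ZMod 2 × ZMod 2) :
    phi ω (toField h2 ω p) = block p 0 0 := by
  obtain ⟨h0, h1⟩ := omega_ne h2 hω
  have h3 : 1 + ω ≠ 0 := fun e => h1 (by
    linear_combination e - h2)
  obtain ⟨a, b⟩ := p
  rw [toField_apply, phi]
  rcases zmod_two_eq_zero_or_one a with rfl | rfl <;>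
    rcases zmod_two_eq_zero_or_one b with rfl | rfl
  · simp [block]
  · simp [block, h0, h1]
  · simp [block]
  · simp [block, h0, h3]; decide

/-- `phi` after this map is the block map, whose kernel is trivial. -/
theorem toField_injective {ω : F} (h2 : (2 : F) = 0) (hω : ω ^ 2 + ω + 1 = 0) :
    Function.Injective (toField h2 ω) := by
  intro p q h
  have e : block (p - q) 0 0 = 0 := by
    rw [← phi_toField h2 hω, map_sub, h, sub_self]
    simp [phi]
  exact sub_eq_zero.1 (block_eq_zero _ _ _ e).1

theorem toField_bitVec_rowBits {ω : F} (h2 : (2 : F) = 0) (hω : ω ^ 2 + ω + 1 = 0) (k : Fin 10)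
    (i : Fin 9) : toField h2 ω (bitVec (rowBits k) i) = genMatrix ω k i := by
  have hsq : ω ^ 2 = 1 + ω := by linear_combination hω - (1 + ω) * h2
  fin_cases k <;> fin_cases i <;>
    simp [toField_apply, bitVec, rowBits, genMatrix, hsq, Nat.testBit]

theorem mem_additiveCode9_iff {ω : F} (h2 : (2 : F) = 0) (hω : ω ^ 2 + ω + 1 = 0)
    (c : Fin 9 → F) : c ∈ additiveCode9 ω ↔ ∃ x, c = fun i => toField h2 ω (word x i) := by
  have hrow : ∀ k, (fun i => toField h2 ω (word (Pi.single k 1) i)) = (genMatrix ω).row k := by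
    intro k
    funext i
    rw [word, Fintype.linearCombination_apply_single, one_smul, toField_bitVec_rowBits h2 hω]
    rfl
  constructor
  · intro hc
    induction hc using AddSubgroup.closure_induction with
    | mem c hc => obtain ⟨k, rfl⟩ := hc; exact ⟨_, (hrow k).symm⟩
    | zero => exact ⟨0, by funext i; simp⟩
    | add c d _ _ hc hd =>
      obtain ⟨x, rfl⟩ := hc
      obtain ⟨y, rfl⟩ := hd
      exact ⟨x + y, by funext i; simp⟩
    | neg c _ hc =>
      obtain ⟨x, rfl⟩ := hc
      exact ⟨-x, by funext i; simp⟩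
  · rintro ⟨x, rfl⟩
    have e : (fun i => toField h2 ω (word x i))
        = ∑ k, fun i => toField h2 ω (word (Pi.single k (x k)) i) := by
      funext i
      rw [Finset.sum_apply, ← map_sum, ← Finset.sum_apply, ← map_sum, Finset.univ_sum_single]
    rw [e]
    refine AddSubgroup.sum_mem _ fun k _ => ?_
    rcases zmod_two_eq_zero_or_one (x k) with h | h <;> rw [h]
    · simp only [Pi.single_zero, map_zero, Pi.zero_apply]
      exact (additiveCode9 ω).zero_mem
    · rw [hrow]
      exact AddSubgroup.subset_closure ⟨k, rfl⟩

theorem card_additiveCode9 {ω : F} (h2 : (2 : F) = 0) (hω : ω ^ 2 + ω + 1 = 0) :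
    Nat.card (additiveCode9 ω) = 2 ^ 10 := by
  have hinj : Function.Injective (fun x i => toField h2 ω (word x i)) := fun x y h =>
    word_injective (funext fun i => toField_injective h2 hω (congrFun h i))
  have hrange : (additiveCode9 ω : Set (Fin 9 → F))
      = Set.range (fun x i => toField h2 ω (word x i)) := by
    ext c
    rw [SetLike.mem_coe, mem_additiveCode9_iff h2 hω, Set.mem_range]
    simp only [eq_comm]
  change Nat.card (additiveCode9 ω : Set (Fin 9 → F)) = _
  rw [hrange, Nat.card_range_of_injective hinj, Nat.card_eq_fintype_card, Fintype.card_fun,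
    ZMod.card, Fintype.card_fin]

theorem mem_phiCode_iff {ω : F} (h2 : (2 : F) = 0) (hω : ω ^ 2 + ω + 1 = 0)
    (v : Fin (9 * 4) → ZMod 2) :
    v ∈ phiCode ω (additiveCode9 ω) ↔ ∃ x, v = encode (x, 0, 0) := by
  have e : ∀ x, ofBlocks (fun i => phi ω (toField h2 ω (word x i))) = encode (x, 0, 0) := fun x =>
    congrArg (ofBlocks (m := 9)) (funext fun i => phi_toField h2 hω _)
  constructor
  · rintro ⟨c, hc, rfl⟩
    obtain ⟨x, rfl⟩ := (mem_additiveCode9_iff h2 hω c).1 hc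
    exact ⟨x, e x⟩
  · rintro ⟨x, rfl⟩
    exact ⟨_, (mem_additiveCode9_iff h2 hω _).2 ⟨x, rfl⟩, (e x).symm⟩

theorem setOf_add_eq_binaryCode {ω : F} (h2 : (2 : F) = 0) (hω : ω ^ 2 + ω + 1 = 0) (κ : ZMod 2) :
    {v : Fin (9 * 4) → ZMod 2 | ∃ a ∈ phiCode ω (additiveCode9 ω),
      ∃ b ∈ Submodule.span (ZMod 2) (evenSums 9 ∪ {encode (0, Pi.single 8 κ, 1)}), v = a + b}
      = (binaryCode κ : Set (Fin 36 → ZMod 2)) := by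
  have hadd : ∀ x y ε, encode (x, 0, 0) + encode (0, y, ε) = encode (x, y, ε) := fun x y ε => by
    rw [← map_add]; simp
  ext v
  constructor
  · rintro ⟨a, ha, b, hb, rfl⟩
    obtain ⟨x, rfl⟩ := (mem_phiCode_iff h2 hω a).1 ha
    obtain ⟨y, ε, h, rfl⟩ := (mem_span_evenSums_iff κ b).1 hb
    exact (hadd x y ε).symm ▸ encode_mem_binaryCode h
  · rintro ⟨⟨x, y, ε⟩, h, rfl⟩
    exact ⟨_, (mem_phiCode_iff h2 hω _).2 ⟨x, rfl⟩, _,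
      (mem_span_evenSums_iff κ _).2 ⟨y, ε, mem_ker_parityFunctional.1 h, rfl⟩, (hadd x y ε).symm⟩

theorem codeO36_eq {ω : F} (h2 : (2 : F) = 0) (hω : ω ^ 2 + ω + 1 = 0) :
    codeO36 ω = (binaryCode 0 : Set (Fin 36 → ZMod 2)) := by
  rw [← setOf_add_eq_binaryCode h2 hω, ← dOne_eq_encode, codeO36, rhoO, dCodeO,
    if_pos (by decide)]

theorem codeE36_eq {ω : F} (h2 : (2 : F) = 0) (hω : ω ^ 2 + ω + 1 = 0) :
    codeE36 ω = (binaryCode 1 : Set (Fin 36 → ZMod 2)) := by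
  rw [← setOf_add_eq_binaryCode h2 hω, ← dTwo_eq_encode, codeE36, rhoE, dCodeE,
    if_neg (by decide)]

end Field

theorem proposition2 {F : Type*} [Field F] (hF : Nat.card F = 4)
    (ω : F) (hω : ω ^ 2 + ω + 1 = 0) :
    Nat.card (additiveCode9 ω) = 2 ^ 10 ∧
    IsOptimalLinearCode 36 19 8 (codeO36 ω) ∧
    IsOptimalLinearCode 36 19 8 (codeE36 ω) ∧
    weightDistribution (codeO36 ω) ≠ weightDistribution (codeE36 ω) ∧
    ¬ CodeEquivalent (codeO36 ω) (codeE36 ω) := by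
  have h2 := two_eq_zero_of_card_four hF
  rw [codeO36_eq h2 hω, codeE36_eq h2 hω]
  exact ⟨card_additiveCode9 h2 hω, isOptimalLinearCode_binaryCode 0,
    isOptimalLinearCode_binaryCode 1, weightDistribution_binaryCode_ne,
    fun h => weightDistribution_binaryCode_ne h.weightDistribution_eq⟩
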